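/- Let $\Gamma$ be a connected compact metric graph: finitely many vertices and edges, at least one edge, no loops and no multiple edges, each edge ${\bf e}$, with initial vertex $\mathrm i_{\bf e}$ and terminal vertex $\mathrm f_{\bf e}$, being identified with an interval $[0,\ell_{\bf e}]$ with $0<\ell_{\bf e}<\infty$. Let $\ell(A)$ denote the length of $A\subset\Gamma$, i.e. the sum over the edges of the Lebesgue measure of $A\cap{\bf e}$. A function $u$ on $\Gamma$ is a collection of functions $[u]_{\bf e}$ on $(0,\ell_{\bf e})$; the spaces $L^1(\Gamma)$, $L^\infty(\Gamma)$, $BV(\Gamma)$, $W^{1,2}(\Gamma)$ are defined edge by edge (no continuity at the vertices is required), $\int_\Gamma u=\sum_{\bf e}\int_0^{\ell_{\bf e}}[u]_{\bf e}$ and $\|u\|_1=\int_\Gamma|u|$. Let $X_K(\Gamma)$ be the set of ${\bf z}\in W^{1,2}(\Gamma)$ such that $\sum_{{\bf e}\ni{\bf v}}[{\bf z}]_{\bf e}({\bf v})=0$ for every vertex ${\bf v}$, where, for the continuous representative of ${\bf z}$ on each edge, $[{\bf z}]_{\bf e}({\bf v})=[{\bf z}]_{\bf e}(\ell_{\bf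 e})$ if ${\bf v}=\mathrm f_{\bf e}$ and $[{\bf z}]_{\bf e}({\bf v})=-[{\bf z}]_{\bf e}(0)$ if ${\bf v}=\mathrm i_{\bf e}$. For $u\in BV(\Gamma)$ put $$TV_\Gamma(u)=\sup\Big\{\Big|\int_\Gamma u\,{\bf z}'\Big| : {\bf z}\in X_K(\Gamma),\ \|{\bf z}\|_{L^\infty(\Gamma)}\le 1\Big\},$$ and put $TV_\Gamma(u)=+\infty$ for $u\in L^1(\Gamma)\setminus BV(\Gamma)$. For measurable $D\subset\Gamma$ let ${\rm Per}_\Gamma(D)=TV_\Gamma(\chi_D)$, and let $$h(\Gamma)=\inf\Big\{\frac{{\rm Per}_\Gamma(D)}{\min\{\ell(D),\ell(\Gamma\setminus D)\}} : D\subset\Gamma\text{ measurable},\ 0<\ell(D)<\ell(\Gamma)\Big\}$$ be the Cheeger constant of $\Gamma$. A real number $\mu$ is a median of $u$, written $\mu\in{\rm med}_\ell(u)$, if $\ell(\{u<\mu\})\le\frac12\ell(\Gamma)$ and $\ell(\{u>\mu\})\le\frac12\ell(\Gamma)$. Then $$h(\Gamma)=\min\Big\{\frac{TV_\Gamma(u)}{\|u-\mu\|_1}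 : u\in L^1(\Gamma)\text{ not a.e. constant},\ \mu\in{\rm med}_\ell(u)\Big\} =\inf\Big\{\sup_{c\in\mathbb R}\frac{TV_\Gamma(u)}{\|u-c\|_1} : u\in L^1(\Gamma)\text{ not a.e. constant}\Big\},$$ where the minimum is attained. -/

import Mathlib

open MeasureTheory Set
open scoped ENNReal ContDiff

/-- A connected compact metric graph with (finite) vertex set `V` and (finite) edge set `E`:
each edge is an ordered pair of distinct vertices (its initial and its terminal vertex) with a
finite positive length; there are no loops and no multiple edges, and the underlying
combinatorial graph is connected. -/
structure CompactMetricGraph (V E : Type*) [Fintype V] [Fintype E] where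
  src : E → V
  tgt : E → V
  len : E → ℝ
  len_pos : ∀ e, 0 < len e
  no_loops : ∀ e, src e ≠ tgt e
  no_multiple_edges : Function.Injective fun e => s(src e, tgt e)
  connected : (SimpleGraph.fromEdgeSet (Set.range fun e => s(src e, tgt e))).Connected

namespace CompactMetricGraph

variable {V E : Type*} [Fintype V] [Fintype E] (Γ : CompactMetricGraph V E)

/-- The points of the metric graph: its vertices and the interior points of its edges, the
latter given by the edge and the coordinate in `(0, ℓ_e)`. -/
inductive Point : Type _
  | vertex (v : V) : Point
  | inner (e : E) (t : ℝ) (ht : t ∈ Ioo 0 (Γ.len e)) : Point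

open Classical in
/-- The point of the edge `e` with coordinate `t ∈ [0, ℓ_e]` (for `t` outside this interval the
nearer end point is returned; such `t` are never used). -/
noncomputable def pt (e : E) (t : ℝ) : Γ.Point :=
  if h : t ∈ Ioo 0 (Γ.len e) then .inner e t h
  else if t ≤ 0 then .vertex (Γ.src e) else .vertex (Γ.tgt e)

/-- The set `c_e(A ∩ e) ⊆ [0, ℓ_e]` of the coordinates of the points of `A` on the edge `e`. -/
def coords (A : Set Γ.Point) (e : E) : Set ℝ :=
  {t | t ∈ Icc 0 (Γ.len e) ∧ Γ.pt e t ∈ A}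

/-- The length `ℓ(A)`: the sum over the edges of the Lebesgue measure of `c_e(A ∩ e)`. -/
noncomputable def length (A : Set Γ.Point) : ℝ≥0∞ :=
  ∑ e, volume (Γ.coords A e)

/-- (Lebesgue) measurable subsets of the graph. -/
def MeasSet (A : Set Γ.Point) : Prop :=
  ∀ e, NullMeasurableSet (Γ.coords A e) volume

/-- The restriction `[u]_e` of a function on the graph to an edge, in the coordinate of the edge.
Only its values on `(0, ℓ_e)` are used. -/
noncomputable def onEdge (u : Γ.Point → ℝ) (e : E) : ℝ → ℝ := fun t => u (Γ.pt e t)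

/-- `u ∈ L¹(Γ)`. -/
def MemL1 (u : Γ.Point → ℝ) : Prop :=
  ∀ e, IntegrableOn (Γ.onEdge u e) (Ioo 0 (Γ.len e)) volume

/-- The norm `‖u‖₁` of `L¹(Γ)`. -/
noncomputable def l1norm (u : Γ.Point → ℝ) : ℝ≥0∞ :=
  ∑ e, eLpNorm (Γ.onEdge u e) 1 (volume.restrict (Ioo 0 (Γ.len e)))

/-- `u` is almost everywhere equal to a constant. -/
def AEConst (u : Γ.Point → ℝ) : Prop :=
  ∃ c : ℝ, ∀ e, ∀ᵐ t ∂volume.restrict (Ioo 0 (Γ.len e)), Γ.onEdge u e t = c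

end CompactMetricGraph

/-- `φ` is a test function on the open interval `(a, b)`: `φ ∈ C_c^∞(a, b)`. -/
def IsTestFun (a b : ℝ) (φ : ℝ → ℝ) : Prop :=
  ContDiff ℝ ∞ φ ∧ HasCompactSupport φ ∧ tsupport φ ⊆ Ioo a b

/-- `f ∈ BV(a, b)`: `f ∈ L¹(a, b)` and its distributional derivative is a finite signed Radon
measure, written as the difference `p - n` of two finite positive Borel measures. (As test
functions vanish outside `(a, b)`, only the restrictions of `p` and `n` to `(a, b)` matter.) -/
def IsBVOn (a b : ℝ) (f : ℝ → ℝ) : Prop :=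
  IntegrableOn f (Ioo a b) volume ∧
  ∃ p n : Measure ℝ, IsFiniteMeasure p ∧ IsFiniteMeasure n ∧
    ∀ φ, IsTestFun a b φ →
      ∫ t in Ioo a b, f t * deriv φ t = -(∫ t, φ t ∂p - ∫ t, φ t ∂n)

/-- `z ∈ W^{1,2}(a, b)` with weak derivative `dz`, where `z` is the representative that is
continuous on `[a, b]`. -/
def IsW12On (a b : ℝ) (z dz : ℝ → ℝ) : Prop :=
  ContinuousOn z (Icc a b) ∧
  MemLp z 2 (volume.restrict (Ioo a b)) ∧ MemLp dz 2 (volume.restrict (Ioo a b)) ∧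
  ∀ φ, IsTestFun a b φ →
    ∫ t in Ioo a b, z t * deriv φ t = -∫ t in Ioo a b, dz t * φ t

namespace CompactMetricGraph

variable {V E : Type*} [Fintype V] [Fintype E] (Γ : CompactMetricGraph V E)

/-- `u ∈ BV(Γ)`: `[u]_e ∈ BV(0, ℓ_e)` on each edge; no continuity is asked at the vertices. -/
def MemBV (u : Γ.Point → ℝ) : Prop :=
  ∀ e, IsBVOn 0 (Γ.len e) (Γ.onEdge u e)

open Classical in
/-- The set `E_v` of the edges incident to `v`. -/
noncomputable def incident (v : V) : Finset E :=
  {e | Γ.src e = v ∨ Γ.tgt e = v}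

open Classical in
/-- The outgoing value `[z]_e(v)` at a vertex `v` of the edge `e`: it is `z_e(ℓ_e)` at the
terminal vertex of `e` and `-z_e(0)` at its initial vertex. -/
noncomputable def vertexValue (z : E → ℝ → ℝ) (e : E) (v : V) : ℝ :=
  if v = Γ.tgt e then z e (Γ.len e) else -z e 0

/-- `z ∈ X_K(Γ)` with weak derivative `dz`: `z` belongs to `W^{1,2}(Γ)` (that is, edge by edge) and
satisfies the Kirchhoff condition at every vertex. -/
def IsKirchhoffField (z dz : E → ℝ → ℝ) : Prop :=
  (∀ e, IsW12On 0 (Γ.len e) (z e) (dz e)) ∧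
  ∀ v, ∑ e ∈ Γ.incident v, Γ.vertexValue z e v = 0

/-- `‖z‖_{L^∞(Γ)} ≤ 1`. -/
def SupNormLeOne (z : E → ℝ → ℝ) : Prop :=
  ∀ e, ∀ᵐ t ∂volume.restrict (Ioo 0 (Γ.len e)), |z e t| ≤ 1

open Classical in
/-- The total variation `TV_Γ(u)`: for `u ∈ BV(Γ)` it is the supremum of `|∫_Γ u z'|` over all
`z ∈ X_K(Γ)` with `‖z‖_∞ ≤ 1`, and it is `∞` for `u ∉ BV(Γ)`. -/
noncomputable def TV (u : Γ.Point → ℝ) : ℝ≥0∞ :=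
  if Γ.MemBV u then
    ⨆ (z : E → ℝ → ℝ) (dz : E → ℝ → ℝ) (_ : Γ.IsKirchhoffField z dz) (_ : Γ.SupNormLeOne z),
      ENNReal.ofReal |∑ e, ∫ t in Ioo 0 (Γ.len e), Γ.onEdge u e t * dz e t|
  else ∞

/-- The `Γ`-perimeter of a set: the total variation of its characteristic function. -/
noncomputable def Per (D : Set Γ.Point) : ℝ≥0∞ :=
  Γ.TV (D.indicator fun _ => 1)

/-- The Cheeger constant `h(Γ)`. -/
noncomputable def cheeger : ℝ≥0∞ :=
  ⨅ (D : Set Γ.Point) (_ : Γ.MeasSet D) (_ : 0 < Γ.length D) (_ : Γ.length D < Γ.length univ),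
    Γ.Per D / min (Γ.length D) (Γ.length Dᶜ)

/-- `μ` is a median of `u` with respect to the length. -/
def IsMedian (u : Γ.Point → ℝ) (μ : ℝ) : Prop :=
  Γ.length {x | u x < μ} ≤ Γ.length univ / 2 ∧ Γ.length {x | μ < u x} ≤ Γ.length univ / 2

end CompactMetricGraph

/-! Cut every edge into n + 1 equal cells and let κ be the infimum, over all n and all nontrivial
0-1 patterns on the cells, of `cut` divided by the smaller of the two complementary lengths
(`gridQuotients`). The theorem follows once κ is shown to bound all median quotients from below and
to be attained by a set.

Lower bound: TV(u) ≥ κ‖u - μ‖₁ for every integrable u with median μ. Instead of a coarea formula,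
`exists_calibration` provides one nodal field that is optimal for all superlevel sets of given cell
values simultaneously: at an inner node it is the sign of the drop, and at a vertex it is the sign
of the trace minus a median of the traces, corrected on ties so that Kirchhoff's condition holds.
Adding up the isoperimetric inequalities of the level sets (`sum_mul_nonneg_of_superlevel`) gives
the inequality for cell values, `GridIsoperimetric.exists_field`. The piecewise linear interpolant z
of the nodal field is admissible for TV, and z' is constant on cells, so that ∫ u z' only sees the
cell averages of u (`exists_interpolation`). These averages converge to u in L¹ on fine grids. The
constant produced on each grid need not be μ, but a median minimises the L¹ distance to constants.

Attainment (`exists_optimal_set`): along a minimising sequence of patterns the cuts stay bounded, so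
each edge carries a bounded number of jumps and the patterns are described by points of a fixed
compact box. A convergent subsequence yields a limit set D. Connectedness gives every nontrivial
pattern a cut of at least one, so the smaller length cannot tend to zero and D is nontrivial. For a
fixed admissible z, sampling at the nodes bounds the pairing with each pattern by its cut
(`abs_sum_integral_stepFun_le_cut`); passing to the limit bounds Per(D).

Finally, 0 or 1 is a median of an indicator, so each Cheeger quotient is a median quotient, and the
supremum over c is reached at a median. -/

/-! ### Medians, layer-cake summation and calibrations for finite families. -/

section FiniteSums

variable {ι : Type*}

/-- A weighted finite family of real numbers has a median. -/
theorem exists_weighted_median (S : Finset ι) (a w : ι → ℝ) (hw : ∀ i ∈ S, 0 ≤ w i) :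
    ∃ m : ℝ, 2 * ∑ i ∈ S with m < a i, w i ≤ ∑ i ∈ S, w i ∧
      2 * ∑ i ∈ S with a i < m, w i ≤ ∑ i ∈ S, w i := by
  classical
  rcases S.eq_empty_or_nonempty with rfl | hS
  · exact ⟨0, by simp⟩
  have htot : 0 ≤ ∑ i ∈ S, w i := Finset.sum_nonneg hw
  let T := S.filter fun j => 2 * ∑ i ∈ S with a j < a i, w i ≤ ∑ i ∈ S, w i
  have hT : T.Nonempty := by
    obtain ⟨j, hj, hmax⟩ := S.exists_max_image a hS
    refine ⟨j, Finset.mem_filter.2 ⟨hj, ?_⟩⟩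
    rw [Finset.filter_false_of_mem fun i hi => not_lt.2 (hmax i hi)]
    simpa using htot
  obtain ⟨j, hj, hmin⟩ := T.exists_min_image a hT
  refine ⟨a j, (Finset.mem_filter.1 hj).2, ?_⟩
  rcases (S.filter fun i => a i < a j).eq_empty_or_nonempty with h0 | hR
  · rw [h0]; simpa using htot
  -- The median `a j` is the least value with at most half of the weight strictly above it. The next
  -- smaller value `a k` violates that condition, and the weight above `a k` is disjoint from the
  -- weight below `a j`.
  obtain ⟨k, hk, hmax⟩ := (S.filter fun i => a i < a j).exists_max_image a hR
  obtain ⟨hkS, hkj⟩ := Finset.mem_filter.1 hk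
  have hkT : ∑ i ∈ S, w i < 2 * ∑ i ∈ S with a k < a i, w i := by
    by_contra! h
    exact absurd (hmin k (Finset.mem_filter.2 ⟨hkS, h⟩)) (not_le.2 hkj)
  have hdisj : Disjoint (S.filter fun i => a i < a j) (S.filter fun i => a k < a i) := by
    rw [Finset.disjoint_left]
    intro i hi hi'
    exact absurd (hmax i hi) (not_le.2 (Finset.mem_filter.1 hi').2)
  have hle : ∑ i ∈ S with a i < a j, w i + ∑ i ∈ S with a k < a i, w i ≤ ∑ i ∈ S, w i := by
    rw [← Finset.sum_union hdisj]
    exact Finset.sum_le_sum_of_subset_of_nonneg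
      (Finset.union_subset (Finset.filter_subset _ _) (Finset.filter_subset _ _))
      fun i hi _ => hw i hi
  linarith

/-- A finite layer-cake argument: b is a nonnegative combination of indicators of its superlevel
sets. The induction peels off the smallest positive value of b, which lowers the number of positive
entries. -/
theorem sum_mul_nonneg_of_superlevel (S : Finset ι) (b q : ι → ℝ) (hb : ∀ i ∈ S, 0 ≤ b i)
    (h : ∀ t : ℝ, 0 ≤ t → 0 ≤ ∑ i ∈ S with t < b i, q i) : 0 ≤ ∑ i ∈ S, b i * q i := by
  classical
  induction hn : (S.filter fun i => 0 < b i).card using Nat.strong_induction_on generalizing b with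
  | _ n ih =>
  rcases (S.filter fun i => 0 < b i).eq_empty_or_nonempty with h0 | hne
  · refine (Finset.sum_eq_zero fun i hi => ?_).ge
    have : ¬ 0 < b i := Finset.filter_eq_empty_iff.1 h0 hi
    rw [le_antisymm (not_lt.1 this) (hb i hi), zero_mul]
  obtain ⟨j, hj, hmin⟩ := (S.filter fun i => 0 < b i).exists_min_image b hne
  obtain ⟨hjS, hj0⟩ := Finset.mem_filter.1 hj
  let b' : ι → ℝ := fun i => if 0 < b i then b i - b j else 0
  have hlev : ∀ t : ℝ, 0 ≤ t → ∀ i ∈ S, (t < b' i ↔ t + b j < b i) := by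
    intro t ht i _
    by_cases hi0 : 0 < b i
    · simp only [b', if_pos hi0]; constructor <;> intro <;> linarith
    · simp only [b', if_neg hi0]; constructor <;> intro <;> linarith
  have hsplit : ∑ i ∈ S, b i * q i = ∑ i ∈ S, b' i * q i + b j * ∑ i ∈ S with 0 < b i, q i := by
    rw [Finset.sum_filter, Finset.mul_sum, ← Finset.sum_add_distrib]
    refine Finset.sum_congr rfl fun i hi => ?_
    by_cases hi0 : 0 < b i
    · simp only [b', if_pos hi0]; ring
    · simp only [b', if_neg hi0]
      rw [le_antisymm (not_lt.1 hi0) (hb i hi)]; ring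
  rw [hsplit]
  refine add_nonneg (ih _ ?_ b' ?_ ?_ rfl) (mul_nonneg hj0.le (h 0 le_rfl))
  · rw [← hn]
    refine Finset.card_lt_card ⟨fun i hi => ?_, fun hsub => ?_⟩
    · obtain ⟨hiS, hi0⟩ := Finset.mem_filter.1 hi
      have := (hlev 0 le_rfl i hiS).1 hi0
      exact Finset.mem_filter.2 ⟨hiS, by linarith⟩
    · have := (hlev 0 le_rfl j hjS).1 (Finset.mem_filter.1 (hsub hj)).2
      linarith
  · intro i hi
    by_cases hi0 : 0 < b i
    · simp only [b', if_pos hi0]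
      have := hmin i (Finset.mem_filter.2 ⟨hi, hi0⟩)
      linarith
    · simp only [b', if_neg hi0]; exact le_rfl
  · intro t ht
    rw [Finset.filter_congr (hlev t ht)]
    exact h _ (by linarith)

/-- A finite family `a` has a balanced field `x` that calibrates all its level sets at once. -/
theorem exists_balanced_calibration (S : Finset ι) (a : ι → ℝ) :
    ∃ x : ι → ℝ, (∀ i, |x i| ≤ 1) ∧ ∑ i ∈ S, x i = 0 ∧
      ∀ b : ι → ℝ, (∀ i ∈ S, b i = 0 ∨ b i = 1) → (∀ i ∈ S, ∀ j ∈ S, a i ≤ a j → b i ≤ b j) →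
        min (∑ i ∈ S, b i) (∑ i ∈ S, (1 - b i)) ≤ ∑ i ∈ S, b i * x i := by
  classical
  obtain ⟨m, h1, h2⟩ := exists_weighted_median S a (fun _ => 1) (fun _ _ => zero_le_one)
  set P := ∑ i ∈ S with m < a i, (1 : ℝ) with hP
  set Q := ∑ i ∈ S with a i < m, (1 : ℝ) with hQ
  set R := ∑ i ∈ S with a i = m, (1 : ℝ) with hR
  have hPQR : ∑ i ∈ S, (1 : ℝ) = P + Q + R := by
    rw [hP, hQ, hR, Finset.sum_filter, Finset.sum_filter, Finset.sum_filter,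
      ← Finset.sum_add_distrib, ← Finset.sum_add_distrib]
    refine Finset.sum_congr rfl fun i _ => ?_
    rcases lt_trichotomy (a i) m with h | h | h
    · simp [h, h.not_gt, h.ne]
    · simp [h]
    · simp [h, h.not_gt, h.ne']
  have hR0 : 0 ≤ R := Finset.sum_nonneg fun _ _ => zero_le_one
  -- The two median inequalities say exactly |Q - P| ≤ R. If R = 0 they force P = Q, so the
  -- quotient, then zero by convention, still balances the sum.
  have hθ : |(Q - P) / R| ≤ 1 := by
    rw [abs_div, abs_of_nonneg hR0]
    exact div_le_one_of_le₀ (abs_le.2 ⟨by linarith, by linarith⟩) hR0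
  have hθR : (Q - P) / R * R = Q - P := by
    rcases eq_or_ne R 0 with h0 | h0
    · rw [h0]; linarith
    · exact div_mul_cancel₀ _ h0
  let x : ι → ℝ := fun i => if m < a i then 1 else if a i < m then -1 else (Q - P) / R
  have hx0 : ∑ i ∈ S, x i = 0 := by
    have : ∑ i ∈ S, x i = P - Q + (Q - P) / R * R := by
      rw [hP, hQ, hR, Finset.mul_sum, Finset.sum_filter, Finset.sum_filter, Finset.sum_filter,
        ← Finset.sum_sub_distrib, ← Finset.sum_add_distrib]
      refine Finset.sum_congr rfl fun i _ => ?_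
      rcases lt_trichotomy (a i) m with h | h | h
      · simp [x, h, h.not_gt, h.ne]
      · simp [x, h, hP, hQ, hR]
      · simp [x, h, h.not_gt, h.ne']
    rw [this, hθR]; ring
  refine ⟨x, fun i => ?_, hx0, fun b hb hmono => ?_⟩
  · simp only [x]
    split_ifs <;> simp [hθ]
  -- If {b = 1} reaches down to the median, monotonicity puts {b = 0} inside {x = -1} and, since x
  -- has sum zero, the pairing counts {b = 0}. Otherwise {b = 1} lies inside {x = 1} and the pairing
  -- counts {b = 1}.
  by_cases hex : ∃ i ∈ S, b i = 1 ∧ a i ≤ m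
  · obtain ⟨i, hi, hbi, hai⟩ := hex
    refine (min_le_right _ _).trans (le_of_eq ?_)
    have : ∑ j ∈ S, b j * x j = ∑ j ∈ S, x j - ∑ j ∈ S, (1 - b j) * x j := by
      rw [← Finset.sum_sub_distrib]; exact Finset.sum_congr rfl fun _ _ => by ring
    rw [this, hx0, zero_sub, ← Finset.sum_neg_distrib]
    refine Finset.sum_congr rfl fun j hj => ?_
    rcases hb j hj with h | h
    · have hlt : a j < m := by
        by_contra! hge
        have := hmono i hi j hj (hai.trans hge)
        rw [hbi, h] at this; linarith
      simp [x, h, hlt, hlt.not_gt]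
    · simp [h]
  · push Not at hex
    refine (min_le_left _ _).trans (le_of_eq (Finset.sum_congr rfl fun j hj => ?_))
    rcases hb j hj with h | h
    · simp [h]
    · simp [x, h, hex j hj h]

/-- Abel summation, arranged so that jumps meet the inner nodes and the two end nodes remain as
boundary terms. -/
theorem sum_range_mul_sub (n : ℕ) (b η : ℕ → ℝ) :
    ∑ i ∈ Finset.range (n + 1), b i * (η (i + 1) - η i) =
      ∑ k ∈ Finset.range n, (b k - b (k + 1)) * η (k + 1) + (b n * η (n + 1) - b 0 * η 0) := by
  induction n with
  | zero => simp; ring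
  | succ n ih => rw [Finset.sum_range_succ, ih, Finset.sum_range_succ _ n]; ring

end FiniteSums

/-! ### Duality between cuts and nodal Kirchhoff fields. -/

namespace CompactMetricGraph

variable {V E : Type*} [Fintype V] [Fintype E] (Γ : CompactMetricGraph V E)

theorem sum_incident (F : E → V → ℝ) :
    ∑ v, ∑ e ∈ Γ.incident v, F e v = ∑ e, (F e (Γ.tgt e) + F e (Γ.src e)) := by
  classical
  have h : ∀ v, ∑ e ∈ Γ.incident v, F e v =
      ∑ e, ((if Γ.tgt e = v then F e v else 0) + (if Γ.src e = v then F e v else 0)) := by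
    intro v
    rw [incident, Finset.sum_filter]
    refine Finset.sum_congr rfl fun e _ => ?_
    by_cases h1 : Γ.src e = v
    · have h2 : Γ.tgt e ≠ v := fun h2 => Γ.no_loops e (h1.trans h2.symm)
      simp [h1, h2]
    · simp [h1]
  simp_rw [h]
  rw [Finset.sum_comm]
  refine Finset.sum_congr rfl fun e _ => ?_
  rw [Finset.sum_add_distrib]
  simp

open Classical in
/-- The value next to `v` of a pattern `b` on `n + 1` consecutive cells of the edge `e`. -/
noncomputable def cellTrace (n : ℕ) (b : E → ℕ → ℝ) (e : E) (v : V) : ℝ :=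
  if v = Γ.tgt e then b e n else b e 0

open Classical in
/-- The outgoing value at `v` of a field given at the `n + 2` nodes of the edge `e`. -/
noncomputable def nodeValue (n : ℕ) (η : E → ℕ → ℝ) (e : E) (v : V) : ℝ :=
  if v = Γ.tgt e then η e (n + 1) else -η e 0

/-- A field on the nodes that is bounded by one and satisfies the Kirchhoff condition. -/
def IsNodalField (n : ℕ) (η : E → ℕ → ℝ) : Prop :=
  (∀ e i, |η e i| ≤ 1) ∧ ∀ v, ∑ e ∈ Γ.incident v, Γ.nodeValue n η e v = 0

/-- The combinatorial perimeter of a pattern `b` with values in `{0, 1}` on the cells. -/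
noncomputable def cut (n : ℕ) (b : E → ℕ → ℝ) : ℝ :=
  ∑ e, ∑ k ∈ Finset.range n, |b e k - b e (k + 1)| +
    ∑ v, min (∑ e ∈ Γ.incident v, Γ.cellTrace n b e v)
      (∑ e ∈ Γ.incident v, (1 - Γ.cellTrace n b e v))

variable {n : ℕ} {b : E → ℕ → ℝ} {η : E → ℕ → ℝ}

theorem cellTrace_eq_zero_or_one (hb : ∀ e i, b e i = 0 ∨ b e i = 1) (e : E) (v : V) :
    Γ.cellTrace n b e v = 0 ∨ Γ.cellTrace n b e v = 1 := by
  unfold cellTrace; split_ifs <;> exact hb _ _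

/-- Discrete integration by parts. The sign convention for outgoing values turns the boundary terms
of the edges into sums over the vertices. -/
theorem sum_cells_mul_sub (n : ℕ) (b η : E → ℕ → ℝ) :
    ∑ e, ∑ i ∈ Finset.range (n + 1), b e i * (η e (i + 1) - η e i) =
      ∑ e, ∑ k ∈ Finset.range n, (b e k - b e (k + 1)) * η e (k + 1) +
        ∑ v, ∑ e ∈ Γ.incident v, Γ.cellTrace n b e v * Γ.nodeValue n η e v := by
  rw [sum_incident Γ fun e v => Γ.cellTrace n b e v * Γ.nodeValue n η e v,
    ← Finset.sum_add_distrib]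
  refine Finset.sum_congr rfl fun e _ => ?_
  rw [sum_range_mul_sub]
  simp only [cellTrace, nodeValue, Γ.no_loops e, if_true, if_false]
  ring

/-- Weak duality. At a vertex the Kirchhoff condition allows b to be replaced by b - 1, so both
entries of the minimum bound the vertex term. -/
theorem sum_cells_le_cut (hb : ∀ e i, b e i = 0 ∨ b e i = 1) (hη : Γ.IsNodalField n η) :
    ∑ e, ∑ i ∈ Finset.range (n + 1), b e i * (η e (i + 1) - η e i) ≤ Γ.cut n b := by
  have hval : ∀ e v, |Γ.nodeValue n η e v| ≤ 1 := by
    intro e v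
    unfold nodeValue
    split_ifs
    · exact hη.1 _ _
    · rw [abs_neg]; exact hη.1 _ _
  rw [Γ.sum_cells_mul_sub, cut]
  refine add_le_add (Finset.sum_le_sum fun e _ => Finset.sum_le_sum fun k _ => ?_)
    (Finset.sum_le_sum fun v _ => le_min (Finset.sum_le_sum fun e _ => ?_) ?_)
  · calc _ ≤ |(b e k - b e (k + 1)) * η e (k + 1)| := le_abs_self _
      _ = |b e k - b e (k + 1)| * |η e (k + 1)| := abs_mul _ _
      _ ≤ _ := mul_le_of_le_one_right (abs_nonneg _) (hη.1 _ _)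
  · have := (abs_le.1 (hval e v)).2
    rcases Γ.cellTrace_eq_zero_or_one (n := n) hb e v with h | h <;> rw [h] <;> linarith
  · have : ∑ e ∈ Γ.incident v, Γ.cellTrace n b e v * Γ.nodeValue n η e v =
        ∑ e ∈ Γ.incident v, -((1 - Γ.cellTrace n b e v) * Γ.nodeValue n η e v) := by
      rw [← sub_eq_zero, ← Finset.sum_sub_distrib, ← hη.2 v]
      exact Finset.sum_congr rfl fun _ _ => by ring
    rw [this]
    refine Finset.sum_le_sum fun e _ => ?_
    have := (abs_le.1 (hval e v)).1
    rcases Γ.cellTrace_eq_zero_or_one (n := n) hb e v with h | h <;> rw [h] <;> linarith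

theorem IsNodalField.neg (hη : Γ.IsNodalField n η) :
    Γ.IsNodalField n fun e i => -η e i := by
  refine ⟨fun e i => by rw [abs_neg]; exact hη.1 e i, fun v => ?_⟩
  rw [← neg_eq_zero, ← Finset.sum_neg_distrib, ← hη.2 v]
  refine Finset.sum_congr rfl fun e _ => ?_
  unfold nodeValue
  split_ifs <;> simp

theorem abs_sum_cells_le_cut (hb : ∀ e i, b e i = 0 ∨ b e i = 1) (hη : Γ.IsNodalField n η) :
    |∑ e, ∑ i ∈ Finset.range (n + 1), b e i * (η e (i + 1) - η e i)| ≤ Γ.cut n b := by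
  refine abs_le'.2 ⟨Γ.sum_cells_le_cut hb hη, le_of_eq_of_le ?_ (Γ.sum_cells_le_cut hb hη.neg)⟩
  simp_rw [← Finset.sum_neg_distrib]
  refine Finset.sum_congr rfl fun e _ => Finset.sum_congr rfl fun i _ => ?_
  ring

/-- One nodal field calibrates all level sets of a pattern. -/
theorem exists_calibration (n : ℕ) (a : E → ℕ → ℝ) :
    ∃ ζ : E → ℕ → ℝ, Γ.IsNodalField n ζ ∧ ∀ b : E → ℕ → ℝ, (∀ e i, b e i = 0 ∨ b e i = 1) →
      (∀ e i e' i', a e i ≤ a e' i' → b e i ≤ b e' i') →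
      Γ.cut n b ≤ ∑ e, ∑ i ∈ Finset.range (n + 1), b e i * (ζ e (i + 1) - ζ e i) := by
  choose x hx1 hx0 hx using fun v =>
    exists_balanced_calibration (Γ.incident v) fun e => Γ.cellTrace n a e v
  -- The minus sign at node 0 cancels the one in the outgoing value at the initial vertex. At an
  -- inner node the field is the sign of the drop of a.
  let ζ : E → ℕ → ℝ := fun e i =>
    if i = 0 then -x (Γ.src e) e else if i = n + 1 then x (Γ.tgt e) e
      else if a e i < a e (i - 1) then 1 else if a e (i - 1) < a e i then -1 else 0
  have hval : ∀ v, ∀ e ∈ Γ.incident v, Γ.nodeValue n ζ e v = x v e := by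
    intro v e he
    simp only [incident, Finset.mem_filter, Finset.mem_univ, true_and] at he
    unfold nodeValue
    by_cases h : v = Γ.tgt e
    · simp [ζ, h]
    · have : Γ.src e = v := he.resolve_right fun h' => h h'.symm
      simp [ζ, h, this]
  refine ⟨ζ, ⟨fun e i => ?_, fun v => ?_⟩, fun b hb hmono => ?_⟩
  · simp only [ζ]
    split_ifs <;> simp [hx1]
  · rw [Finset.sum_congr rfl (hval v), hx0 v]
  rw [Γ.sum_cells_mul_sub, cut]
  refine add_le_add (Finset.sum_le_sum fun e _ => Finset.sum_le_sum fun k hk => ?_)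
    (Finset.sum_le_sum fun v _ => ?_)
  · have hk' : k ≠ n := (Finset.mem_range.1 hk).ne
    rcases lt_trichotomy (b e k) (b e (k + 1)) with h | h | h
    -- A strict jump of b forces a strict jump of a in the same direction, so ζ has the right sign
    -- at each jump of each level set.
    · have : a e k < a e (k + 1) := by
        by_contra! h'; exact absurd (hmono _ _ _ _ h') (not_le.2 h)
      simp only [ζ, Nat.add_eq_zero_iff, one_ne_zero, and_false, if_false, Nat.add_right_cancel_iff,
        hk', Nat.add_sub_cancel, this, this.not_gt, if_true]
      rw [abs_of_neg (sub_neg.2 h)]; linarith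
    · simp [h]
    · have : a e (k + 1) < a e k := by
        by_contra! h'; exact absurd (hmono _ _ _ _ h') (not_le.2 h)
      simp only [ζ, Nat.add_eq_zero_iff, one_ne_zero, and_false, if_false, Nat.add_right_cancel_iff,
        hk', Nat.add_sub_cancel, this, if_true]
      rw [abs_of_pos (sub_pos.2 h)]; linarith
  · have hsum : ∑ e ∈ Γ.incident v, Γ.cellTrace n b e v * Γ.nodeValue n ζ e v =
        ∑ e ∈ Γ.incident v, Γ.cellTrace n b e v * x v e :=
      Finset.sum_congr rfl fun e he => by rw [hval v e he]
    rw [hsum]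
    refine hx v _ (fun e _ => Γ.cellTrace_eq_zero_or_one hb e v) fun e _ e' _ h => ?_
    revert h
    unfold cellTrace
    split_ifs <;> exact hmono _ _ _ _

theorem cut_summands_nonneg (hb : ∀ e i, b e i = 0 ∨ b e i = 1) (v : V) :
    0 ≤ min (∑ e ∈ Γ.incident v, Γ.cellTrace n b e v)
      (∑ e ∈ Γ.incident v, (1 - Γ.cellTrace n b e v)) := by
  refine le_min (Finset.sum_nonneg fun e _ => ?_) (Finset.sum_nonneg fun e _ => ?_) <;>
  rcases Γ.cellTrace_eq_zero_or_one (n := n) hb e v with h | h <;> rw [h] <;> norm_num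

theorem sum_jumps_le_cut (hb : ∀ e i, b e i = 0 ∨ b e i = 1) (e : E) :
    ∑ k ∈ Finset.range n, |b e k - b e (k + 1)| ≤ Γ.cut n b := by
  refine le_add_of_le_of_nonneg ?_ (Finset.sum_nonneg fun v _ => Γ.cut_summands_nonneg hb v)
  exact Finset.single_le_sum (f := fun e => ∑ k ∈ Finset.range n, |b e k - b e (k + 1)|)
    (fun e _ => Finset.sum_nonneg fun k _ => abs_nonneg _) (Finset.mem_univ e)

theorem vertex_le_cut (hb : ∀ e i, b e i = 0 ∨ b e i = 1) (v : V) :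
    min (∑ e ∈ Γ.incident v, Γ.cellTrace n b e v)
      (∑ e ∈ Γ.incident v, (1 - Γ.cellTrace n b e v)) ≤ Γ.cut n b := by
  refine le_add_of_nonneg_of_le (Finset.sum_nonneg fun e _ => Finset.sum_nonneg fun k _ =>
    abs_nonneg _) ?_
  exact Finset.single_le_sum (f := fun v => min (∑ e ∈ Γ.incident v, Γ.cellTrace n b e v)
      (∑ e ∈ Γ.incident v, (1 - Γ.cellTrace n b e v)))
    (fun v _ => Γ.cut_summands_nonneg hb v) (Finset.mem_univ v)

theorem cut_nonneg (hb : ∀ e i, b e i = 0 ∨ b e i = 1) : 0 ≤ Γ.cut n b :=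
  add_nonneg (Finset.sum_nonneg fun _ _ => Finset.sum_nonneg fun _ _ => abs_nonneg _)
    (Finset.sum_nonneg fun v _ => Γ.cut_summands_nonneg hb v)

/-- A pattern of perimeter less than one is constant, as the graph is connected. -/
theorem eq_of_cut_lt_one (hb : ∀ e i, b e i = 0 ∨ b e i = 1) (h : Γ.cut n b < 1)
    (e e' : E) {i i' : ℕ} (hi : i ≤ n) (hi' : i' ≤ n) : b e i = b e' i' := by
  have hstep : ∀ e, ∀ k < n, b e k = b e (k + 1) := by
    intro e k hk
    by_contra hne
    have h1 : |b e k - b e (k + 1)| = 1 := by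
      rcases hb e k with h1 | h1 <;> rcases hb e (k + 1) with h2 | h2 <;> simp_all
    have h2 := Finset.single_le_sum (f := fun k => |b e k - b e (k + 1)|)
      (fun k _ => abs_nonneg _) (Finset.mem_range.2 hk)
    have := Γ.sum_jumps_le_cut (n := n) hb e
    simp only [h1] at h2
    linarith
  have hedge : ∀ e, ∀ k ≤ n, b e k = b e 0 := by
    intro e k hk
    induction k with
    | zero => rfl
    | succ k ih => rw [← hstep e k hk, ih (by omega)]
  have htr : ∀ e v, Γ.cellTrace n b e v = b e 0 := by
    intro e v
    unfold cellTrace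
    split_ifs
    · exact hedge e n le_rfl
    · rfl
  have hvertex : ∀ v, ∀ e ∈ Γ.incident v, ∀ e' ∈ Γ.incident v, b e 0 = 1 → b e' 0 = 1 := by
    intro v e he e' he' h1
    -- With both traces 0 and 1 present at v, each of the two sums is at least one, hence so is
    -- their minimum, against a cut below one.
    by_contra hne
    have h0 : b e' 0 = 0 := (hb e' 0).resolve_right hne
    have := Γ.vertex_le_cut (n := n) hb v
    simp only [htr] at this
    have h3 := Finset.single_le_sum (f := fun e => b e 0)
      (fun e _ => by rcases hb e 0 with h | h <;> simp [h]) he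
    have h4 := Finset.single_le_sum (f := fun e => 1 - b e 0)
      (fun e _ => by rcases hb e 0 with h | h <;> simp [h]) he'
    simp only [h1, h0] at h3 h4
    exact absurd (lt_of_le_of_lt this h) (not_lt.2 (le_min h3 (by linarith)))
  have hveq : ∀ v, ∀ e ∈ Γ.incident v, ∀ e' ∈ Γ.incident v, b e 0 = b e' 0 := by
    intro v e he e' he'
    rcases hb e 0 with h0 | h0
    · rcases hb e' 0 with h1 | h1
      · rw [h0, h1]
      · rw [hvertex v e' he' e he h1, h1]
    · rw [h0, hvertex v e he e' he' h0]
  have hsrc : ∀ e, e ∈ Γ.incident (Γ.src e) := fun e => by simp [incident]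
  have hwalk : ∀ v w, (SimpleGraph.fromEdgeSet (Set.range fun e => s(Γ.src e, Γ.tgt e))).Walk v w →
      ∀ e ∈ Γ.incident v, ∀ e' ∈ Γ.incident w, b e 0 = b e' 0 := by
    intro v w p
    induction p with
    | nil => exact hveq _
    | @cons u v w hadj p ih =>
      intro e he e' he'
      obtain ⟨⟨f, hf⟩, -⟩ := (SimpleGraph.fromEdgeSet_adj _).1 hadj
      have hf' : f ∈ Γ.incident u ∧ f ∈ Γ.incident v := by
        simp only [incident, Finset.mem_filter, Finset.mem_univ, true_and]
        rcases Sym2.eq_iff.1 hf with ⟨h1, h2⟩ | ⟨h1, h2⟩ <;> simp [h1, h2]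
      exact (hveq u e he f hf'.1).trans (ih f hf'.2 e' he')
  rw [hedge e i hi, hedge e' i' hi']
  obtain ⟨p⟩ := Γ.connected.preconnected (Γ.src e) (Γ.src e')
  exact hwalk _ _ p e (hsrc e) e' (hsrc e')

end CompactMetricGraph

/-! ### Sobolev functions on an interval: primitives and the fundamental theorem of calculus. -/

section OneDimensional

variable {a b : ℝ}

theorem setIntegral_Ioo_eq_intervalIntegral (hab : a ≤ b) (f : ℝ → ℝ) :
    ∫ t in Ioo a b, f t = ∫ t in a..b, f t := by
  rw [intervalIntegral.integral_of_le hab, integral_Ioc_eq_integral_Ioo]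

theorem MeasureTheory.MemLp.intervalIntegrable_of_Ioo {g : ℝ → ℝ}
    (hab : a ≤ b) (hg : MemLp g 2 (volume.restrict (Ioo a b))) :
    IntervalIntegrable g volume a b :=
  (intervalIntegrable_iff_integrableOn_Ioo_of_le hab).2 (hg.integrable one_le_two)

theorem IsTestFun.apply_left {φ : ℝ → ℝ} (h : IsTestFun a b φ) : φ a = 0 :=
  image_eq_zero_of_notMem_tsupport fun ha => (lt_irrefl a) (h.2.2 ha).1

theorem IsTestFun.apply_right {φ : ℝ → ℝ} (h : IsTestFun a b φ) : φ b = 0 :=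
  image_eq_zero_of_notMem_tsupport fun hb => (lt_irrefl b) (h.2.2 hb).2

theorem integral_primitive_mul_deriv {g φ : ℝ → ℝ}
    (hg : IntervalIntegrable g volume a b) (hφ : ContDiff ℝ ∞ φ) :
    ∫ t in a..b, (∫ s in a..t, g s) * deriv φ t =
      (∫ s in a..b, g s) * φ b - ∫ t in a..b, g t * φ t := by
  have hF := hg.absolutelyContinuousOnInterval_intervalIntegral (left_mem_uIcc)
  have hφ' : AbsolutelyContinuousOnInterval φ a b :=
    (hφ.of_le (by simp)).contDiffOn.absolutelyContinuousOnInterval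
  rw [hF.integral_mul_deriv_eq_deriv_mul hφ', intervalIntegral.integral_same, zero_mul, sub_zero]
  congr 1
  refine intervalIntegral.integral_congr_ae ?_
  filter_upwards [hg.ae_hasDerivAt_integral] with t ht htm
  rw [(ht (uIoc_subset_uIcc htm) a left_mem_uIcc).deriv]

theorem integral_mul_deriv_primitive_test {g φ : ℝ → ℝ} (hab : a ≤ b)
    (hg : IntervalIntegrable g volume a b) (hφ : IsTestFun a b φ) (c : ℝ) :
    ∫ t in Ioo a b, (c + ∫ s in a..t, g s) * deriv φ t = -∫ t in Ioo a b, g t * φ t := by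
  have hd : Continuous (deriv φ) := hφ.1.continuous_deriv (by simp)
  have hF : ContinuousOn (fun t => ∫ s in a..t, g s) (uIcc a b) :=
    intervalIntegral.continuousOn_primitive_interval' hg left_mem_uIcc
  rw [setIntegral_Ioo_eq_intervalIntegral hab, setIntegral_Ioo_eq_intervalIntegral hab]
  simp_rw [add_mul]
  have hFd : IntervalIntegrable (fun t => (∫ s in a..t, g s) * deriv φ t) volume a b :=
    (hF.mul hd.continuousOn).intervalIntegrable
  rw [intervalIntegral.integral_add ((hd.intervalIntegrable _ _).const_mul c) hFd,
    integral_primitive_mul_deriv hg hφ.1,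
    intervalIntegral.integral_const_mul, intervalIntegral.integral_deriv_eq_sub'  φ rfl
      (fun x _ => (hφ.1.differentiable (by simp)).differentiableAt) hd.continuousOn,
    hφ.apply_left, hφ.apply_right]
  ring

/-- A primitive of an `L²` function belongs to `W^{1,2}`. -/
theorem isW12On_primitive {g : ℝ → ℝ} (hab : a ≤ b)
    (hg : MemLp g 2 (volume.restrict (Ioo a b))) (c : ℝ) :
    IsW12On a b (fun t => c + ∫ s in a..t, g s) g := by
  have hgi := hg.intervalIntegrable_of_Ioo hab
  have hcont : ContinuousOn (fun t => c + ∫ s in a..t, g s) (Icc a b) := by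
    rw [← uIcc_of_le hab]
    exact continuousOn_const.add
      (intervalIntegral.continuousOn_primitive_interval' hgi left_mem_uIcc)
  refine ⟨hcont, ?_, hg, fun φ hφ => integral_mul_deriv_primitive_test hab hgi hφ c⟩
  obtain ⟨C, hC⟩ := isCompact_Icc.exists_bound_of_continuousOn hcont
  refine MemLp.of_bound ((hcont.mono Ioo_subset_Icc_self).aestronglyMeasurable measurableSet_Ioo) C
    ((ae_restrict_mem measurableSet_Ioo).mono fun t ht => hC t (Ioo_subset_Icc_self ht))

/-- A continuous function on an interval whose distributional derivative vanishes is constant. -/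
theorem exists_eqOn_const_of_forall_integral_mul_deriv_eq_zero {F : ℝ → ℝ} (hab : a < b)
    (hF : ContinuousOn F (Icc a b))
    (h : ∀ φ, IsTestFun a b φ → ∫ t in Ioo a b, F t * deriv φ t = 0) :
    ∃ k, ∀ t ∈ Icc a b, F t = k := by
  let ρ : ContDiffBump ((a + b) / 2) :=
    ⟨(b - a) / 8, (b - a) / 4, by linarith, by linarith⟩
  set ψ₀ : ℝ → ℝ := ρ.normed volume with hψ₀
  have hψ₀s : ContDiff ℝ ∞ ψ₀ := ρ.contDiff_normed
  have hψ₀t : tsupport ψ₀ ⊆ Ioo a b := by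
    rw [hψ₀, ρ.tsupport_normed_eq, Real.closedBall_eq_Icc]
    rintro x ⟨h1, h2⟩
    simp only [ρ] at h1 h2
    constructor <;> linarith
  have hψ₀c : HasCompactSupport ψ₀ := ρ.hasCompactSupport_normed
  set k := ∫ t in Ioo a b, F t * ψ₀ t with hk
  have hint : ∀ ψ : ℝ → ℝ, Continuous ψ → tsupport ψ ⊆ Ioo a b →
      ∫ t in a..b, ψ t = ∫ t, ψ t := by
    intro ψ _ hψ
    rw [← setIntegral_Ioo_eq_intervalIntegral hab.le]
    exact setIntegral_eq_integral_of_forall_compl_eq_zero fun t ht =>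
      image_eq_zero_of_notMem_tsupport fun h => ht (hψ h)
  have hFi : ∀ ψ : ℝ → ℝ, Continuous ψ → IntegrableOn (fun t => F t * ψ t) (Ioo a b) := by
    intro ψ hψ
    exact (hF.mul hψ.continuousOn).integrableOn_Icc.mono_set Ioo_subset_Icc_self
  have key : ∀ ψ : ℝ → ℝ, ContDiff ℝ ∞ ψ → HasCompactSupport ψ → tsupport ψ ⊆ Ioo a b →
      ∫ t in Ioo a b, F t * ψ t = (∫ t, ψ t) * k := by
    intro ψ hψ hψc hψt
    set I := ∫ t, ψ t with hI
    -- Subtracting the unit-mass bump ψ₀ times the mean of ψ leaves total mass zero, so the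
    -- primitive of θ is a test function and may be inserted into the hypothesis.
    let θ : ℝ → ℝ := fun t => ψ t - I * ψ₀ t
    have hθ : ContDiff ℝ ∞ θ := hψ.sub (contDiff_const.mul hψ₀s)
    let φ : ℝ → ℝ := fun x => ∫ t in a..x, θ t
    have hderiv : deriv φ = θ := by
      ext x
      exact hθ.continuous.deriv_integral θ a x
    have hφs : ContDiff ℝ ∞ φ := by
      refine contDiff_infty_iff_deriv.2 ⟨fun x => ?_, by rwa [hderiv]⟩
      exact (intervalIntegral.integral_hasDerivAt_right (hθ.continuous.intervalIntegrable _ _)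
        (hθ.continuous.stronglyMeasurableAtFilter _ _) hθ.continuous.continuousAt).differentiableAt
    have htot : ∫ t in a..b, θ t = 0 := by
      rw [intervalIntegral.integral_sub (hψ.continuous.intervalIntegrable _ _)
        ((hψ₀s.continuous.intervalIntegrable _ _).const_mul I),
        intervalIntegral.integral_const_mul, hint ψ hψ.continuous hψt,
        hint ψ₀ hψ₀s.continuous hψ₀t, hψ₀, ρ.integral_normed]
      simp [hI]
    set K := insert ((a + b) / 2) (tsupport ψ ∪ tsupport ψ₀) with hK
    have hKc : IsCompact K := (IsCompact.union hψc hψ₀c).insert _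
    have hKs : K ⊆ Ioo a b :=
      insert_subset ⟨by linarith, by linarith⟩ (union_subset hψt hψ₀t)
    have hKne : K.Nonempty := insert_nonempty _ _
    obtain ⟨c, hcK, hc⟩ := hKc.exists_isLeast hKne
    obtain ⟨d, hdK, hd⟩ := hKc.exists_isGreatest hKne
    have hθ0 : ∀ t ∉ K, θ t = 0 := by
      intro t ht
      simp only [hK, mem_insert_iff, mem_union, not_or] at ht
      simp [θ, image_eq_zero_of_notMem_tsupport ht.2.1, image_eq_zero_of_notMem_tsupport ht.2.2]
    -- Left of c the integrand vanishes; right of d the primitive equals the total mass, which is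
    -- zero.
    have hφ0 : ∀ x ∉ Icc c d, φ x = 0 := by
      intro x hx
      rcases not_and_or.1 hx with hx | hx
      · have : ∀ t ∈ uIcc a x, θ t = (0 : ℝ) := by
          intro t ht
          refine hθ0 t fun htK => ?_
          have := hc htK
          have h2 := (hKs hcK).1
          rcases le_total a x with hax | hax
          · rw [uIcc_of_le hax] at ht; linarith [ht.2]
          · rw [uIcc_of_ge hax] at ht; linarith [ht.2]
        simp only [φ]
        rw [intervalIntegral.integral_congr (g := fun _ => (0 : ℝ)) this]
        simp
      · have : ∀ t ∈ uIcc x b, θ t = (0 : ℝ) := by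
          intro t ht
          refine hθ0 t fun htK => ?_
          have := hd htK
          have h2 := (hKs hdK).2
          rcases le_total x b with hax | hax
          · rw [uIcc_of_le hax] at ht; linarith [ht.1]
          · rw [uIcc_of_ge hax] at ht; linarith [ht.1]
        simp only [φ]
        have h3 := intervalIntegral.integral_add_adjacent_intervals
          (hθ.continuous.intervalIntegrable (μ := volume) a x)
          (hθ.continuous.intervalIntegrable (μ := volume) x b)
        rw [htot, intervalIntegral.integral_congr (g := fun _ => (0 : ℝ)) this] at h3
        simpa using h3
    have hφt : tsupport φ ⊆ Icc c d :=
      closure_minimal (fun x hx => by_contra fun hx' => hx (hφ0 x hx')) isClosed_Icc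
    have hφ : IsTestFun a b φ := by
      refine ⟨hφs, HasCompactSupport.of_support_subset_isCompact isCompact_Icc
        ((subset_tsupport φ).trans hφt), hφt.trans fun x hx => ?_⟩
      exact ⟨(hKs hcK).1.trans_le hx.1, hx.2.trans_lt (hKs hdK).2⟩
    have h0 := h φ hφ
    rw [hderiv] at h0
    have : ∀ t, F t * θ t = F t * ψ t - I * (F t * ψ₀ t) := fun t => by simp only [θ]; ring
    simp_rw [this] at h0
    rw [integral_sub (hFi ψ hψ.continuous) ((hFi ψ₀ hψ₀s.continuous).const_mul I),
      integral_const_mul] at h0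
    linarith
  have hae := isOpen_Ioo.ae_eq_zero_of_integral_contDiff_smul_eq_zero (μ := volume)
    (f := fun t => F t - k) (U := Ioo a b)
    (((hF.sub continuousOn_const).mono Ioo_subset_Icc_self).locallyIntegrableOn measurableSet_Ioo)
    (by
      intro ψ hψ hψc hψt
      rw [← setIntegral_eq_integral_of_forall_compl_eq_zero (s := Ioo a b) fun t ht => by
        rw [image_eq_zero_of_notMem_tsupport fun h => ht (hψt h), zero_smul]]
      have h1 : ∀ t, ψ t • (F t - k) = F t * ψ t - k * ψ t := fun t => by
        rw [smul_eq_mul]; ring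
      simp_rw [h1]
      rw [integral_sub (hFi ψ hψ.continuous)
        ((hψ.continuous.integrable_of_hasCompactSupport hψc).integrableOn.const_mul k),
        key ψ hψ hψc hψt, integral_const_mul, setIntegral_Ioo_eq_intervalIntegral hab.le,
        hint ψ hψ.continuous hψt]
      ring)
  refine ⟨k, Measure.eqOn_Icc_of_ae_eq (g := fun _ => k) volume hab.ne ?_ hF continuousOn_const⟩
  rw [← restrict_Ioo_eq_restrict_Icc]
  refine (ae_restrict_iff' measurableSet_Ioo).2 (hae.mono fun t ht htm => ?_)
  exact sub_eq_zero.1 (ht htm)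

theorem IsW12On.intervalIntegrable {z dz : ℝ → ℝ} (h : IsW12On a b z dz) (hab : a ≤ b) :
    IntervalIntegrable dz volume a b :=
  h.2.2.1.intervalIntegrable_of_Ioo hab

/-- The fundamental theorem of calculus in `W^{1,2}`. -/
theorem IsW12On.integral_eq_sub {z dz : ℝ → ℝ} (h : IsW12On a b z dz) (hab : a < b) {s t : ℝ}
    (hs : s ∈ Icc a b) (ht : t ∈ Icc a b) : ∫ x in s..t, dz x = z t - z s := by
  have hi := h.intervalIntegrable hab.le
  have hc : ContinuousOn (fun t => ∫ x in a..t, dz x) (Icc a b) := by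
    rw [← uIcc_of_le hab.le]
    exact intervalIntegral.continuousOn_primitive_interval' hi left_mem_uIcc
  -- z and the primitive of dz have the same distributional derivative, so their difference is
  -- constant.
  obtain ⟨k, hk⟩ := exists_eqOn_const_of_forall_integral_mul_deriv_eq_zero hab (h.1.sub hc)
    fun φ hφ => by
      have hd : Continuous (deriv φ) := hφ.1.continuous_deriv (by simp)
      simp_rw [Pi.sub_apply, sub_mul]
      have h1 : IntegrableOn (fun t => z t * deriv φ t) (Ioo a b) :=
        (h.1.mul hd.continuousOn).integrableOn_Icc.mono_set Ioo_subset_Icc_self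
      have h2 : IntegrableOn (fun t => (∫ x in a..t, dz x) * deriv φ t) (Ioo a b) :=
        (hc.mul hd.continuousOn).integrableOn_Icc.mono_set Ioo_subset_Icc_self
      rw [integral_sub h1 h2, h.2.2.2 φ hφ]
      have := integral_mul_deriv_primitive_test hab.le hi hφ 0
      simp only [zero_add] at this
      rw [this, sub_self]
  have hmono : ∀ {u}, u ∈ Icc a b → IntervalIntegrable dz volume a u := fun hu =>
    hi.mono_set (by rw [uIcc_of_le hab.le, uIcc_of_le hu.1]; exact Icc_subset_Icc_right hu.2)
  rw [← intervalIntegral.integral_interval_sub_left (hmono ht) (hmono hs)]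
  have h1 := hk s hs
  have h2 := hk t ht
  simp only [Pi.sub_apply] at h1 h2
  linarith

/-- Continuity extends the almost everywhere bound to the end points too, as needed for the values
at the vertices. -/
theorem abs_le_one_of_ae_of_continuousOn {z : ℝ → ℝ} (hab : a < b) (hz : ContinuousOn z (Icc a b))
    (h : ∀ᵐ t ∂volume.restrict (Ioo a b), |z t| ≤ 1) : ∀ t ∈ Icc a b, |z t| ≤ 1 := by
  have := Measure.eqOn_Icc_of_ae_eq (f := fun t => max |z t| 1) (g := fun _ => (1 : ℝ)) volume
    hab.ne (by
      rw [← restrict_Ioo_eq_restrict_Icc]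
      exact h.mono fun t ht => max_eq_right ht)
    (hz.abs.sup continuousOn_const) continuousOn_const
  exact fun t ht => max_eq_right_iff.1 (this ht)

end OneDimensional

/-! ### Step functions, cell averages and interpolation on uniform grids. -/

section Grid

variable {δ : ℝ}

/-- The step function with value `c i` on the cell `[i δ, (i + 1) δ)`. -/
noncomputable def stepFun (δ : ℝ) (c : ℕ → ℝ) (t : ℝ) : ℝ := c ⌊t / δ⌋₊

/-- The mean value of `u` over the cell `(i δ, (i + 1) δ)`. -/
noncomputable def cellAvg (δ : ℝ) (u : ℝ → ℝ) (i : ℕ) : ℝ :=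
  (∫ t in (i * δ)..((i + 1 : ℕ) * δ), u t) / δ

theorem cell_le (hδ : 0 < δ) (i : ℕ) : i * δ ≤ (i + 1 : ℕ) * δ := by
  gcongr; simp

theorem cell_length (i : ℕ) : (i + 1 : ℕ) * δ - i * δ = δ := by
  push_cast; ring

theorem measurable_stepFun (δ : ℝ) (c : ℕ → ℝ) : Measurable (stepFun δ c) :=
  (measurable_from_top (f := c)).comp (Nat.measurable_floor.comp (measurable_id.div_const δ))

theorem stepFun_eq (hδ : 0 < δ) (c : ℕ → ℝ) {i : ℕ} {t : ℝ} (h1 : i * δ ≤ t)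
    (h2 : t < (i + 1 : ℕ) * δ) : stepFun δ c t = c i := by
  have h : ⌊t / δ⌋₊ = i := by
    rw [Nat.floor_eq_iff (div_nonneg (le_trans (by positivity) h1) hδ.le), le_div_iff₀ hδ,
      div_lt_iff₀ hδ]
    exact ⟨h1, by exact_mod_cast h2⟩
  rw [stepFun, h]

theorem stepFun_eqOn_cell (hδ : 0 < δ) (c : ℕ → ℝ) (i : ℕ) :
    EqOn (stepFun δ c) (fun _ => c i) (uIoo (i * δ) ((i + 1 : ℕ) * δ)) := by
  rw [uIoo_of_le (cell_le hδ i)]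
  exact fun t ht => stepFun_eq hδ c ht.1.le ht.2

theorem intervalIntegrable_cell {u : ℝ → ℝ} {k : ℕ} (hδ : 0 < δ)
    (hu : IntervalIntegrable u volume 0 (k * δ)) {i : ℕ} (hi : i < k) :
    IntervalIntegrable u volume (i * δ) ((i + 1 : ℕ) * δ) := by
  refine hu.mono_set ?_
  rw [uIcc_of_le (cell_le hδ i), uIcc_of_le (by positivity)]
  refine Icc_subset_Icc (by positivity) ?_
  gcongr
  exact_mod_cast hi

theorem sum_integral_cells {u : ℝ → ℝ} {k : ℕ}
    (hu : ∀ i < k, IntervalIntegrable u volume (i * δ) ((i + 1 : ℕ) * δ)) :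
    ∑ i ∈ Finset.range k, ∫ t in (i * δ)..((i + 1 : ℕ) * δ), u t = ∫ t in (0 : ℝ)..(k * δ), u t := by
  have := intervalIntegral.sum_integral_adjacent_intervals (a := fun i : ℕ => i * δ) hu
  simpa using this

theorem intervalIntegrable_stepFun_mul {u : ℝ → ℝ} {k : ℕ} (hδ : 0 < δ) (c : ℕ → ℝ)
    (hu : IntervalIntegrable u volume 0 (k * δ)) {i : ℕ} (hi : i < k) :
    IntervalIntegrable (fun t => stepFun δ c t * u t) volume (i * δ) ((i + 1 : ℕ) * δ) :=
  ((intervalIntegrable_cell hδ hu hi).const_mul (c i)).congr_uIoo fun t ht => by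
    simp only [stepFun_eqOn_cell hδ c i ht]

theorem integral_stepFun_mul {u : ℝ → ℝ} {k : ℕ} (hδ : 0 < δ) (c : ℕ → ℝ)
    (hu : IntervalIntegrable u volume 0 (k * δ)) :
    ∫ t in (0 : ℝ)..(k * δ), stepFun δ c t * u t =
      ∑ i ∈ Finset.range k, c i * ∫ t in (i * δ)..((i + 1 : ℕ) * δ), u t := by
  rw [← sum_integral_cells fun i hi => intervalIntegrable_stepFun_mul hδ c hu hi]
  refine Finset.sum_congr rfl fun i _ => ?_
  rw [← intervalIntegral.integral_const_mul]
  refine intervalIntegral.integral_congr_uIoo fun t ht => ?_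
  simp only [stepFun_eqOn_cell hδ c i ht]

theorem memLp_stepFun (δ : ℝ) (hδ : 0 < δ) (c : ℕ → ℝ) (n : ℕ) :
    MemLp (stepFun δ c) 2 (volume.restrict (Ioo 0 ((n + 1 : ℕ) * δ))) := by
  refine MemLp.of_bound (measurable_stepFun δ c).aestronglyMeasurable
    (∑ i ∈ Finset.range (n + 1), |c i|) ((ae_restrict_mem measurableSet_Ioo).mono fun t ht => ?_)
  have h : ⌊t / δ⌋₊ < n + 1 := by
    rw [Nat.floor_lt (div_nonneg ht.1.le hδ.le), div_lt_iff₀ hδ]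
    exact ht.2
  exact Finset.single_le_sum (f := fun i => |c i|) (fun i _ => abs_nonneg _) (Finset.mem_range.2 h)

theorem exists_cell {n : ℕ} (hδ : 0 < δ) {t : ℝ} (ht : t ∈ Icc 0 ((n + 1 : ℕ) * δ)) :
    ∃ i ≤ n, t ∈ Icc (i * δ) ((i + 1 : ℕ) * δ) := by
  rcases eq_or_lt_of_le ht.2 with h | h
  · exact ⟨n, le_rfl, h ▸ cell_le hδ n, h.le⟩
  · have h0 : 0 ≤ t / δ := div_nonneg ht.1 hδ.le
    refine ⟨⌊t / δ⌋₊, ?_, ?_, ?_⟩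
    · rw [← Nat.lt_succ_iff, Nat.succ_eq_add_one, Nat.floor_lt h0, div_lt_iff₀ hδ]
      exact h
    · exact (le_div_iff₀ hδ).1 (Nat.floor_le h0)
    · rw [← div_le_iff₀ hδ]
      exact_mod_cast (Nat.lt_floor_add_one _).le

/-- Piecewise linear interpolation of a bounded field on the nodes of a grid. -/
theorem exists_interpolation (hδ : 0 < δ) (n : ℕ) (ζ : ℕ → ℝ) (hζ : ∀ i, |ζ i| ≤ 1) :
    ∃ z dz : ℝ → ℝ, IsW12On 0 ((n + 1 : ℕ) * δ) z dz ∧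
      (∀ t ∈ Icc 0 ((n + 1 : ℕ) * δ), |z t| ≤ 1) ∧ z 0 = ζ 0 ∧ z ((n + 1 : ℕ) * δ) = ζ (n + 1) ∧
      ∀ u : ℝ → ℝ, IntervalIntegrable u volume 0 ((n + 1 : ℕ) * δ) →
        ∫ t in Ioo 0 ((n + 1 : ℕ) * δ), u t * dz t =
          ∑ i ∈ Finset.range (n + 1), cellAvg δ u i * (ζ (i + 1) - ζ i) := by
  have hl : 0 ≤ ((n + 1 : ℕ) : ℝ) * δ := by positivity
  let c : ℕ → ℝ := fun i => (ζ (i + 1) - ζ i) / δ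
  have hc : MemLp (stepFun δ c) 2 (volume.restrict (Ioo 0 ((n + 1 : ℕ) * δ))) :=
    memLp_stepFun δ hδ c n
  let z : ℝ → ℝ := fun t => ζ 0 + ∫ s in (0 : ℝ)..t, stepFun δ c s
  have hnode : ∀ k : ℕ, z (k * δ) = ζ k := by
    intro k
    have h1 := integral_stepFun_mul (u := fun _ => 1) (k := k) hδ c
      intervalIntegrable_const
    simp only [mul_one, intervalIntegral.integral_const, cell_length, smul_eq_mul] at h1
    have h2 : ∀ i, c i * δ = ζ (i + 1) - ζ i := fun i => div_mul_cancel₀ _ hδ.ne'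
    simp only [z, h1, h2, Finset.sum_range_sub]
    ring
  have hint := hc.intervalIntegrable_of_Ioo hl
  refine ⟨z, stepFun δ c, isW12On_primitive hl hc (ζ 0), fun t ht => ?_, ?_, hnode (n + 1),
    fun u hu => ?_⟩
  · obtain ⟨i, hi, hti⟩ := exists_cell hδ ht
    have hmono : ∀ {s}, s ∈ Icc 0 ((n + 1 : ℕ) * δ) →
        IntervalIntegrable (stepFun δ c) volume 0 s := fun hs => hint.mono_set (by
      rw [uIcc_of_le hl, uIcc_of_le hs.1]; exact Icc_subset_Icc_right hs.2)
    have hi0 : (i : ℝ) * δ ∈ Icc 0 ((n + 1 : ℕ) * δ) := ⟨by positivity, hti.1.trans ht.2⟩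
    have hzt : z t = ζ i + (t - i * δ) * c i := by
      have h1 := intervalIntegral.integral_interval_sub_left (hmono ht) (hmono hi0)
      have h2 : ∫ s in (i * δ)..t, stepFun δ c s = (t - i * δ) * c i := by
        rw [intervalIntegral.integral_congr_Ioo_of_le (g := fun _ => c i) hti.1
          fun s hs => stepFun_eq hδ c hs.1.le (hs.2.trans_le hti.2),
          intervalIntegral.integral_const, smul_eq_mul]
      have h3 := hnode i
      simp only [z] at h3 ⊢
      linarith
    -- On a cell the interpolant is a convex combination of two nodal values, so the bound by one is
    -- inherited.
    have hcomb : z t = (1 - (t - i * δ) / δ) * ζ i + (t - i * δ) / δ * ζ (i + 1) := by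
      rw [hzt]; simp only [c]; ring
    have hθ0 : 0 ≤ (t - i * δ) / δ := div_nonneg (sub_nonneg.2 hti.1) hδ.le
    have hθ1 : (t - i * δ) / δ ≤ 1 := by
      rw [div_le_one hδ]; have := hti.2; push_cast at this; linarith
    have h1 := abs_le.1 (hζ i)
    have h2 := abs_le.1 (hζ (i + 1))
    rw [hcomb, abs_le]
    constructor <;> nlinarith
  · simpa using hnode 0
  -- The derivative is constant on each cell, so the pairing only sees the cell averages of u.
  · rw [setIntegral_Ioo_eq_intervalIntegral hl]
    simp_rw [mul_comm (u _)]
    rw [integral_stepFun_mul hδ c hu]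
    refine Finset.sum_congr rfl fun i _ => ?_
    simp only [c, cellAvg]; ring

/-- The average is, up to a factor 2, the best constant on the cell. Below, k is the value of a
continuous approximation at the left end. -/
theorem integral_abs_sub_cellAvg_le {u : ℝ → ℝ} (hδ : 0 < δ) {i : ℕ}
    (hu : IntervalIntegrable u volume (i * δ) ((i + 1 : ℕ) * δ)) (k : ℝ) :
    ∫ t in (i * δ)..((i + 1 : ℕ) * δ), |u t - cellAvg δ u i| ≤
      2 * ∫ t in (i * δ)..((i + 1 : ℕ) * δ), |u t - k| := by
  have hle := cell_le hδ i
  have hk : IntervalIntegrable (fun t => u t - k) volume (i * δ) ((i + 1 : ℕ) * δ) :=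
    hu.sub intervalIntegrable_const
  have havg : δ * |k - cellAvg δ u i| ≤ ∫ t in (i * δ)..((i + 1 : ℕ) * δ), |u t - k| := by
    have h1 : δ * (k - cellAvg δ u i) = -∫ t in (i * δ)..((i + 1 : ℕ) * δ), (u t - k) := by
      rw [intervalIntegral.integral_sub hu intervalIntegrable_const,
        intervalIntegral.integral_const, cell_length, smul_eq_mul, cellAvg, mul_sub,
        mul_div_cancel₀ _ hδ.ne']
      ring
    rw [← abs_of_pos hδ, ← abs_mul, abs_of_pos hδ, h1, abs_neg]
    exact intervalIntegral.abs_integral_le_integral_abs hle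
  calc ∫ t in (i * δ)..((i + 1 : ℕ) * δ), |u t - cellAvg δ u i|
      ≤ ∫ t in (i * δ)..((i + 1 : ℕ) * δ), (|u t - k| + |k - cellAvg δ u i|) :=
        intervalIntegral.integral_mono_on hle (hu.sub intervalIntegrable_const).abs
          (hk.abs.add intervalIntegrable_const) fun t _ => abs_sub_le _ _ _
    _ = (∫ t in (i * δ)..((i + 1 : ℕ) * δ), |u t - k|) + δ * |k - cellAvg δ u i| := by
        rw [intervalIntegral.integral_add hk.abs intervalIntegrable_const,
          intervalIntegral.integral_const, cell_length, smul_eq_mul]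
    _ ≤ _ := by linarith

/-- Cell averages on fine uniform grids approximate an integrable function in `L¹`. -/
theorem exists_sum_integral_abs_sub_cellAvg_le {l : ℝ} (hl : 0 < l) {u : ℝ → ℝ}
    (hu : IntervalIntegrable u volume 0 l) {ε : ℝ} (hε : 0 < ε) :
    ∃ N : ℕ, ∀ n ≥ N, ∑ i ∈ Finset.range (n + 1),
      ∫ t in (i * (l / (n + 1 : ℕ)))..((i + 1 : ℕ) * (l / (n + 1 : ℕ))),
        |u t - cellAvg (l / (n + 1 : ℕ)) u i| ≤ ε := by
  have hu' : Integrable ((Ioc 0 l).indicator u) :=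
    (integrable_indicator_iff measurableSet_Ioc).2
      ((intervalIntegrable_iff_integrableOn_Ioc_of_le hl.le).1 hu)
  -- The approximation error and the oscillation of g on the cells contribute ε/4 each, and the
  -- comparison with averages doubles the sum.
  obtain ⟨g, -, hg, hgc, hgi⟩ := hu'.exists_hasCompactSupport_integral_sub_le
    (show 0 < ε / 4 by positivity)
  have hug : ∫ t in (0 : ℝ)..l, |u t - g t| ≤ ε / 4 := by
    rw [intervalIntegral.integral_of_le hl.le]
    calc ∫ t in Ioc 0 l, |u t - g t| = ∫ t in Ioc 0 l, ‖(Ioc 0 l).indicator u t - g t‖ :=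
          setIntegral_congr_fun measurableSet_Ioc fun t ht => by
            simp only [indicator_of_mem ht, Real.norm_eq_abs]
      _ ≤ ∫ t, ‖(Ioc 0 l).indicator u t - g t‖ :=
          setIntegral_le_integral (hu'.sub hgi).norm (ae_of_all _ fun t => norm_nonneg _)
      _ ≤ ε / 4 := hg
  have hunif := isCompact_Icc.uniformContinuousOn_of_continuous
    (hgc.continuousOn (s := Icc 0 l))
  rw [Metric.uniformContinuousOn_iff_le] at hunif
  obtain ⟨r, hr, hgr⟩ := hunif (ε / (4 * l)) (by positivity)
  obtain ⟨N, hN⟩ := exists_nat_gt (l / r)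
  refine ⟨N, fun n hn => ?_⟩
  set δ := l / (n + 1 : ℕ) with hδ'
  have hδ : 0 < δ := by positivity
  have hnδ : ((n + 1 : ℕ) : ℝ) * δ = l := by
    rw [hδ']; field_simp
  have hδr : δ ≤ r := by
    rw [hδ', div_le_iff₀ (by positivity)]
    rw [div_lt_iff₀ hr] at hN
    have : (N : ℝ) ≤ (n + 1 : ℕ) := by exact_mod_cast hn.trans (Nat.le_succ n)
    nlinarith
  rw [← hnδ] at hu hug
  have hgint : ∀ p q : ℝ, IntervalIntegrable g volume p q := fun p q => hgc.intervalIntegrable p q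
  have hcell : ∀ i ∈ Finset.range (n + 1),
      ∫ t in (i * δ)..((i + 1 : ℕ) * δ), |u t - cellAvg δ u i| ≤
        2 * ((∫ t in (i * δ)..((i + 1 : ℕ) * δ), |u t - g t|) + δ * (ε / (4 * l))) := by
    intro i hi
    have hi' := Finset.mem_range.1 hi
    have hui := intervalIntegrable_cell hδ hu hi'
    refine (integral_abs_sub_cellAvg_le hδ hui (g (i * δ))).trans ?_
    have hle := cell_le hδ i
    have hle2 : ((i + 1 : ℕ) : ℝ) * δ ≤ l := by
      rw [← hnδ]; gcongr; exact Nat.lt_succ_iff.1 hi'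
    gcongr 2 * ?_
    calc ∫ t in (i * δ)..((i + 1 : ℕ) * δ), |u t - g (i * δ)|
        ≤ ∫ t in (i * δ)..((i + 1 : ℕ) * δ), (|u t - g t| + ε / (4 * l)) := by
          refine intervalIntegral.integral_mono_on hle (hui.sub intervalIntegrable_const).abs
            ((hui.sub (hgint _ _)).abs.add intervalIntegrable_const) fun t ht => ?_
          refine (abs_sub_le _ (g t) _).trans ?_
          have h0 : (0 : ℝ) ≤ i * δ := by positivity
          have := hgr t ⟨h0.trans ht.1, ht.2.trans hle2⟩ (i * δ) ⟨h0, hle.trans hle2⟩ (by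
            rw [Real.dist_eq, abs_of_nonneg (sub_nonneg.2 ht.1)]
            have := cell_length (δ := δ) i
            linarith [ht.2])
          rw [Real.dist_eq] at this
          linarith
      _ = _ := by
          rw [intervalIntegral.integral_add (hui.sub (hgint _ _)).abs intervalIntegrable_const,
            intervalIntegral.integral_const, cell_length, smul_eq_mul]
  refine (Finset.sum_le_sum hcell).trans ?_
  rw [← Finset.mul_sum, Finset.sum_add_distrib,
    sum_integral_cells fun i hi =>
      ((intervalIntegrable_cell hδ hu hi).sub (hgint _ _)).abs,
    Finset.sum_const, Finset.card_range, nsmul_eq_mul, ← mul_assoc, hnδ]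
  have : l * (ε / (4 * l)) = ε / 4 := by field_simp
  rw [hnδ] at hug
  rw [this]
  linarith

theorem integral_abs_sub_le_sum_cellAvg {u : ℝ → ℝ} (hδ : 0 < δ) (n : ℕ)
    (hu : IntervalIntegrable u volume 0 ((n + 1 : ℕ) * δ)) (m : ℝ) :
    ∫ t in (0 : ℝ)..((n + 1 : ℕ) * δ), |u t - m| ≤
      ∑ i ∈ Finset.range (n + 1), (∫ t in (i * δ)..((i + 1 : ℕ) * δ), |u t - cellAvg δ u i|) +
        ∑ i ∈ Finset.range (n + 1), |cellAvg δ u i - m| * δ := by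
  rw [← sum_integral_cells fun i hi =>
    ((intervalIntegrable_cell hδ hu hi).sub intervalIntegrable_const).abs,
    ← Finset.sum_add_distrib]
  refine Finset.sum_le_sum fun i hi => ?_
  have hui := intervalIntegrable_cell hδ hu (Finset.mem_range.1 hi)
  calc ∫ t in (i * δ)..((i + 1 : ℕ) * δ), |u t - m|
      ≤ ∫ t in (i * δ)..((i + 1 : ℕ) * δ), (|u t - cellAvg δ u i| + |cellAvg δ u i - m|) :=
        intervalIntegral.integral_mono_on (cell_le hδ i) (hui.sub intervalIntegrable_const).abs
          ((hui.sub intervalIntegrable_const).abs.add intervalIntegrable_const)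
          fun t _ => abs_sub_le _ _ _
    _ = _ := by
        rw [intervalIntegral.integral_add (hui.sub intervalIntegrable_const).abs
          intervalIntegrable_const, intervalIntegral.integral_const, cell_length, smul_eq_mul,
          mul_comm δ]

end Grid

/-! ### From the isoperimetric inequality on grids to the Cheeger inequality in BV. -/

namespace CompactMetricGraph

variable {V E : Type*} [Fintype V] [Fintype E] (Γ : CompactMetricGraph V E)

/-- The length of the set of cells described by a pattern on the grid with `n + 1` cells per
edge. -/
noncomputable def gridLength (n : ℕ) (b : E → ℕ → ℝ) : ℝ :=
  ∑ e, ∑ i ∈ Finset.range (n + 1), b e i * (Γ.len e / (n + 1 : ℕ))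

/-- All grid patterns satisfy the isoperimetric inequality with constant `κ`. -/
def GridIsoperimetric (κ : ℝ) : Prop :=
  ∀ (n : ℕ) (b : E → ℕ → ℝ), (∀ e i, b e i = 0 ∨ b e i = 1) →
    κ * min (Γ.gridLength n b) (∑ e, Γ.len e - Γ.gridLength n b) ≤ Γ.cut n b

/-- The divergence theorem: the pairing of a Kirchhoff field with the constant pattern 1 has no
jumps and balanced vertex terms. -/
theorem sum_cells_eq_zero {n : ℕ} {η : E → ℕ → ℝ} (hη : Γ.IsNodalField n η) :
    ∑ e, ∑ i ∈ Finset.range (n + 1), (η e (i + 1) - η e i) = 0 := by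
  have h := Γ.sum_cells_mul_sub n (fun _ _ => 1) η
  have h1 : ∀ v e, Γ.cellTrace n (fun _ _ => 1) e v = 1 := fun v e => by
    unfold cellTrace; split_ifs <;> rfl
  simpa [h1, hη.2] using h

theorem sum_grid_lengths (n : ℕ) :
    ∑ e, ∑ _i ∈ Finset.range (n + 1), Γ.len e / (n + 1 : ℕ) = ∑ e, Γ.len e := by
  refine Finset.sum_congr rfl fun e _ => ?_
  rw [Finset.sum_const, Finset.card_range, nsmul_eq_mul]
  field_simp

/-- The Cheeger inequality for functions that are constant on the cells of a grid. -/
theorem GridIsoperimetric.exists_field {κ : ℝ} (hκ : Γ.GridIsoperimetric κ) (n : ℕ)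
    (a : E → ℕ → ℝ) :
    ∃ ζ : E → ℕ → ℝ, Γ.IsNodalField n ζ ∧ ∃ m : ℝ,
      κ * ∑ e, ∑ i ∈ Finset.range (n + 1), |a e i - m| * (Γ.len e / (n + 1 : ℕ)) ≤
        ∑ e, ∑ i ∈ Finset.range (n + 1), a e i * (ζ e (i + 1) - ζ e i) := by
  classical
  obtain ⟨ζ, hζ, hcal⟩ := Γ.exists_calibration n a
  let S : Finset (E × ℕ) := Finset.univ ×ˢ Finset.range (n + 1)
  let q : E × ℕ → ℝ := fun p => Γ.len p.1 / (n + 1 : ℕ)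
  let w : E × ℕ → ℝ := fun p => ζ p.1 (p.2 + 1) - ζ p.1 p.2
  let A : E × ℕ → ℝ := fun p => a p.1 p.2
  have hS : ∀ f : E × ℕ → ℝ, ∑ e, ∑ i ∈ Finset.range (n + 1), f (e, i) = ∑ p ∈ S, f p :=
    fun f => (Finset.sum_product _ _ _).symm
  have hq0 : ∀ p, 0 ≤ q p := fun p => div_nonneg (Γ.len_pos _).le (Nat.cast_nonneg _)
  obtain ⟨m, hm1, hm2⟩ := exists_weighted_median S A q fun p _ => hq0 p
  have hqtot : ∑ p ∈ S, q p = ∑ e, Γ.len e := by rw [← hS q]; exact Γ.sum_grid_lengths n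
  have hw0 : ∑ p ∈ S, w p = 0 := by rw [← hS w]; exact Γ.sum_cells_eq_zero hζ
  -- Upward closed predicates cover strict and non-strict superlevel sets at once; the former serve
  -- the part above m, the latter, through complements, the part below.
  have hlevel : ∀ (P : ℝ → Prop) [DecidablePred P], (∀ x y, x ≤ y → P x → P y) →
      κ * min (∑ p ∈ S with P (A p), q p) (∑ p ∈ S, q p - ∑ p ∈ S with P (A p), q p) ≤
        ∑ p ∈ S with P (A p), w p := by
    intro P _ hP
    have hb : ∀ e i, (if P (a e i) then (1 : ℝ) else 0) = 0 ∨
        (if P (a e i) then (1 : ℝ) else 0) = 1 := fun e i => by split_ifs <;> simp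
    have h1 := hκ n (fun e i => if P (a e i) then 1 else 0) hb
    have h2 := hcal (fun e i => if P (a e i) then 1 else 0) hb (by
      intro e i e' i' h
      by_cases h1 : P (a e i)
      · simp [h1, hP _ _ h h1]
      · simp only [h1, if_false]; split_ifs <;> norm_num)
    have h3 := hS fun p => (if P (A p) then (1 : ℝ) else 0) * q p
    have h4 := hS fun p => (if P (A p) then (1 : ℝ) else 0) * w p
    simp only [ite_mul, one_mul, zero_mul] at h3 h4
    rw [Finset.sum_filter, Finset.sum_filter, ← h4, ← h3, hqtot]
    simp only [gridLength, ite_mul, one_mul, zero_mul] at h1 h2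
    exact h1.trans h2
  -- Above the median m a superlevel set has at most half of the length, so the minimum is its own
  -- length and the layer-cake lemma applies.
  have hpos : 0 ≤ ∑ p ∈ S, max (A p - m) 0 * (w p - κ * q p) := by
    refine sum_mul_nonneg_of_superlevel S _ _ (fun p _ => le_max_right _ _) fun t ht => ?_
    have hf : S.filter (fun p => t < max (A p - m) 0) = S.filter (fun p => m + t < A p) := by
      refine Finset.filter_congr fun p _ => ?_
      rw [lt_max_iff, lt_sub_iff_add_lt']
      simp [ht]
    have hl := hlevel (fun x => m + t < x) fun x y hxy hx => hx.trans_le hxy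
    have hsub : ∑ p ∈ S with m + t < A p, q p ≤ ∑ p ∈ S with m < A p, q p :=
      Finset.sum_le_sum_of_subset_of_nonneg
        (fun p hp => Finset.mem_filter.2 ⟨(Finset.mem_filter.1 hp).1, by
          linarith [(Finset.mem_filter.1 hp).2]⟩) fun p _ _ => hq0 p
    rw [min_eq_left (by linarith)] at hl
    rw [hf, Finset.sum_sub_distrib, ← Finset.mul_sum]
    linarith
  have hneg : 0 ≤ ∑ p ∈ S, max (m - A p) 0 * (-w p - κ * q p) := by
    refine sum_mul_nonneg_of_superlevel S _ _ (fun p _ => le_max_right _ _) fun t ht => ?_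
    have hf : S.filter (fun p => t < max (m - A p) 0) = S.filter (fun p => ¬ m - t ≤ A p) := by
      refine Finset.filter_congr fun p _ => ?_
      rw [lt_max_iff, not_le, lt_sub_comm]
      simp [ht]
    have hl := hlevel (fun x => m - t ≤ x) fun x y hxy hx => hx.trans hxy
    have hsub : ∑ p ∈ S with ¬ m - t ≤ A p, q p ≤ ∑ p ∈ S with A p < m, q p :=
      Finset.sum_le_sum_of_subset_of_nonneg
        (fun p hp => Finset.mem_filter.2 ⟨(Finset.mem_filter.1 hp).1, by
          linarith [not_le.1 (Finset.mem_filter.1 hp).2]⟩) fun p _ _ => hq0 p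
    have hq1 := Finset.sum_filter_add_sum_filter_not S (fun p => m - t ≤ A p) q
    have hw1 := Finset.sum_filter_add_sum_filter_not S (fun p => m - t ≤ A p) w
    rw [min_eq_right (by linarith)] at hl
    rw [hf, Finset.sum_sub_distrib, ← Finset.mul_sum, Finset.sum_neg_distrib]
    have : ∑ p ∈ S, q p - ∑ p ∈ S with m - t ≤ A p, q p = ∑ p ∈ S with ¬ m - t ≤ A p, q p := by
      linarith
    rw [this] at hl
    linarith
  refine ⟨ζ, hζ, m, ?_⟩
  rw [hS fun p => |A p - m| * q p, hS fun p => A p * w p]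
  -- The positive and negative parts recombine to A - m and |A - m|; the term with m disappears
  -- because w has sum zero.
  have hsum : ∑ p ∈ S, max (A p - m) 0 * (w p - κ * q p) +
      ∑ p ∈ S, max (m - A p) 0 * (-w p - κ * q p) =
      ∑ p ∈ S, A p * w p - m * ∑ p ∈ S, w p - κ * ∑ p ∈ S, |A p - m| * q p := by
    rw [Finset.mul_sum, Finset.mul_sum, ← Finset.sum_add_distrib, ← Finset.sum_sub_distrib,
      ← Finset.sum_sub_distrib]
    refine Finset.sum_congr rfl fun p _ => ?_
    rcases le_total (A p) m with h | h
    · rw [max_eq_right (by linarith), max_eq_left (by linarith), abs_of_nonpos (by linarith)]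
      ring
    · rw [max_eq_left (by linarith), max_eq_right (by linarith), abs_of_nonneg (by linarith)]
      ring
  rw [hw0] at hsum
  linarith

theorem MemL1.intervalIntegrable {u : Γ.Point → ℝ} (hu : Γ.MemL1 u) (e : E) :
    IntervalIntegrable (Γ.onEdge u e) volume 0 (Γ.len e) :=
  (intervalIntegrable_iff_integrableOn_Ioo_of_le (Γ.len_pos e).le).2 (hu e)

theorem le_TV {u : Γ.Point → ℝ} (hu : Γ.MemBV u) {z dz : E → ℝ → ℝ}
    (hz : Γ.IsKirchhoffField z dz) (hz1 : Γ.SupNormLeOne z) :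
    ENNReal.ofReal |∑ e, ∫ t in Ioo 0 (Γ.len e), Γ.onEdge u e t * dz e t| ≤ Γ.TV u := by
  rw [TV, if_pos hu]
  exact le_iSup_of_le z (le_iSup_of_le dz (le_iSup_of_le hz (le_iSup_of_le hz1 le_rfl)))

/-- Nodal fields test the total variation through the averages over the cells. -/
theorem le_TV_of_isNodalField {u : Γ.Point → ℝ} (hu1 : Γ.MemL1 u) (hu : Γ.MemBV u) {n : ℕ}
    {ζ : E → ℕ → ℝ} (hζ : Γ.IsNodalField n ζ) :
    ENNReal.ofReal (∑ e, ∑ i ∈ Finset.range (n + 1),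
      cellAvg (Γ.len e / (n + 1 : ℕ)) (Γ.onEdge u e) i * (ζ e (i + 1) - ζ e i)) ≤ Γ.TV u := by
  have hδ : ∀ e, 0 < Γ.len e / (n + 1 : ℕ) := fun e => div_pos (Γ.len_pos e) (by positivity)
  have hl : ∀ e, ((n + 1 : ℕ) : ℝ) * (Γ.len e / (n + 1 : ℕ)) = Γ.len e := fun e => by field_simp
  choose z dz hz using fun e => exists_interpolation (hδ e) n (ζ e) (hζ.1 e)
  simp_rw [hl] at hz
  choose hW hz1 hz0 hzl hint using hz
  have hK : Γ.IsKirchhoffField z dz := by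
    refine ⟨hW, fun v => ?_⟩
    rw [← hζ.2 v]
    refine Finset.sum_congr rfl fun e _ => ?_
    simp only [vertexValue, nodeValue, hz0, hzl]
  have h1 : Γ.SupNormLeOne z := fun e =>
    (ae_restrict_mem measurableSet_Ioo).mono fun t ht => hz1 e t (Ioo_subset_Icc_self ht)
  refine le_trans (ENNReal.ofReal_le_ofReal ?_) (Γ.le_TV hu hK h1)
  refine le_trans (le_of_eq ?_) (le_abs_self _)
  exact Finset.sum_congr rfl fun e _ => (hint e _ (MemL1.intervalIntegrable Γ hu1 e)).symm

theorem GridIsoperimetric.exists_ofReal_le_TV {κ : ℝ} (hκ : Γ.GridIsoperimetric κ) (hκ0 : 0 ≤ κ)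
    {u : Γ.Point → ℝ} (hu1 : Γ.MemL1 u) (hu : Γ.MemBV u) {ε : ℝ} (hε : 0 < ε) :
    ∃ m : ℝ, ENNReal.ofReal
      (κ * (∑ e, ((∫ t in (0 : ℝ)..Γ.len e, |Γ.onEdge u e t - m|) - ε))) ≤ Γ.TV u := by
  choose N hN using fun e => exists_sum_integral_abs_sub_cellAvg_le (Γ.len_pos e)
    (MemL1.intervalIntegrable Γ hu1 e) hε
  -- The sum dominates every N e, so one n serves all edges.
  set n := ∑ e, N e with hn
  have hNn : ∀ e, N e ≤ n := fun e => Finset.single_le_sum (f := N) (fun _ _ => zero_le)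
    (Finset.mem_univ e)
  obtain ⟨ζ, hζ, m, hm⟩ := GridIsoperimetric.exists_field Γ hκ n fun e =>
    cellAvg (Γ.len e / (n + 1 : ℕ)) (Γ.onEdge u e)
  refine ⟨m, (ENNReal.ofReal_le_ofReal (le_trans ?_ hm)).trans
    (Γ.le_TV_of_isNodalField hu1 hu hζ)⟩
  refine mul_le_mul_of_nonneg_left (Finset.sum_le_sum fun e _ => ?_) hκ0
  have hδ : 0 < Γ.len e / (n + 1 : ℕ) := div_pos (Γ.len_pos e) (by positivity)
  have hl : ((n + 1 : ℕ) : ℝ) * (Γ.len e / (n + 1 : ℕ)) = Γ.len e := by field_simp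
  have h1 := integral_abs_sub_le_sum_cellAvg (u := Γ.onEdge u e) hδ n
    (by rw [hl]; exact MemL1.intervalIntegrable Γ hu1 e) m
  rw [hl] at h1
  have h2 := hN e n (hNn e)
  linarith

/-- The Cheeger inequality for functions of bounded variation. -/
theorem GridIsoperimetric.ofReal_mul_le_TV {κ : ℝ} (hκ : Γ.GridIsoperimetric κ) (hκ0 : 0 ≤ κ)
    {u : Γ.Point → ℝ} (hu1 : Γ.MemL1 u) (hu : Γ.MemBV u) {N : ℝ}
    (hN : ∀ m : ℝ, N ≤ ∑ e, ∫ t in (0 : ℝ)..Γ.len e, |Γ.onEdge u e t - m|) :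
    ENNReal.ofReal (κ * N) ≤ Γ.TV u := by
  by_cases htop : Γ.TV u = ⊤
  · rw [htop]; exact le_top
  rw [ENNReal.ofReal_le_iff_le_toReal htop]
  refine le_of_forall_pos_le_add fun ε hε => ?_
  -- The added one keeps C positive even when κ = 0; the total error κ |E| ε / C is then at most ε.
  set C : ℝ := κ * Fintype.card E + 1 with hC
  have hC0 : 0 < C := by positivity
  obtain ⟨m, hm⟩ := GridIsoperimetric.exists_ofReal_le_TV Γ hκ hκ0 hu1 hu
    (show 0 < ε / C by positivity)
  rw [ENNReal.ofReal_le_iff_le_toReal htop, Finset.sum_sub_distrib, Finset.sum_const,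
    Finset.card_univ, nsmul_eq_mul, mul_sub] at hm
  have h1 := mul_le_mul_of_nonneg_left (hN m) hκ0
  have h2 : κ * (Fintype.card E * (ε / C)) ≤ ε := by
    rw [← mul_assoc, mul_div_assoc', div_le_iff₀ hC0, hC]
    nlinarith
  linarith

end CompactMetricGraph

/-! ### Step functions with boundedly many jumps as a compact family of parameters. -/

section JumpSum

open Filter Topology

variable {K : ℕ}

/-- The step function with jumps of heights `(p j).1` at the points `(p j).2`. -/
noncomputable def jumpSum (p : Fin K → ℝ × ℝ) (s : ℝ) : ℝ :=
  ∑ j, (p j).1 * (Ici (p j).2).indicator (fun _ => (1 : ℝ)) s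

theorem measurable_jumpSum (p : Fin K → ℝ × ℝ) : Measurable (jumpSum p) :=
  Finset.measurable_sum _ fun _ _ =>
    (measurable_const.indicator measurableSet_Ici).const_mul _

theorem abs_jumpSum_le (p : Fin K → ℝ × ℝ) (hp : ∀ j, (p j).1 ∈ Icc (-1 : ℝ) 1) (s : ℝ) :
    |jumpSum p s| ≤ K := by
  refine (Finset.abs_sum_le_sum_abs _ _).trans ?_
  refine (Finset.sum_le_card_nsmul _ _ 1 fun j _ => ?_).trans (by simp)
  by_cases h : s ∈ Ici (p j).2
  · rw [indicator_of_mem h, mul_one]; exact abs_le.2 (hp j)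
  · rw [indicator_of_notMem h]; simp

theorem integrableOn_jumpSum_mul (p : Fin K → ℝ × ℝ) (hp : ∀ j, (p j).1 ∈ Icc (-1 : ℝ) 1)
    {s : Set ℝ} {g : ℝ → ℝ} (hg : IntegrableOn g s) :
    IntegrableOn (fun t => jumpSum p t * g t) s :=
  hg.bdd_mul (measurable_jumpSum p).aestronglyMeasurable
    (ae_of_all _ fun t => abs_jumpSum_le p hp t)

/-- The derivative is a sum of weighted Dirac masses, split by the sign of the heights. Jumps at 0
or l are harmless because test functions vanish there. -/
theorem isBVOn_jumpSum {l : ℝ} (p : Fin K → ℝ × ℝ)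
    (hp : ∀ j, (p j).1 ∈ Icc (-1 : ℝ) 1) (hp' : ∀ j, (p j).2 ∈ Icc 0 l) :
    IsBVOn 0 l (jumpSum p) := by
  refine ⟨?_, ∑ j, ENNReal.ofReal (p j).1 • Measure.dirac (p j).2,
    ∑ j, ENNReal.ofReal (-(p j).1) • Measure.dirac (p j).2, ?_, ?_, fun φ hφ => ?_⟩
  · have := integrableOn_jumpSum_mul p hp (s := Ioo 0 l) (g := fun _ => 1) (by simp)
    simpa using this
  · have (j : Fin K) := Measure.smul_finite (Measure.dirac (p j).2)
      (ENNReal.ofReal_ne_top (r := (p j).1))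
    infer_instance
  · have (j : Fin K) := Measure.smul_finite (Measure.dirac (p j).2)
      (ENNReal.ofReal_ne_top (r := -(p j).1))
    infer_instance
  have hd : Continuous (deriv φ) := hφ.1.continuous_deriv (by simp)
  have hint : ∀ (c : ℝ) (τ : ℝ), Integrable φ (ENNReal.ofReal c • Measure.dirac τ) := fun c τ =>
    (hφ.1.continuous.integrable_of_hasCompactSupport hφ.2.1 : Integrable φ (Measure.dirac τ)
      ).smul_measure ENNReal.ofReal_ne_top
  rw [integral_finsetSum_measure fun j _ => hint _ _, integral_finsetSum_measure fun j _ => hint _ _]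
  simp_rw [integral_smul_measure, integral_dirac, smul_eq_mul]
  rw [← Finset.sum_sub_distrib, ← Finset.sum_neg_distrib]
  simp_rw [jumpSum, Finset.sum_mul]
  rw [integral_finsetSum]
  · refine Finset.sum_congr rfl fun j _ => ?_
    simp_rw [mul_assoc]
    rw [integral_const_mul]
    have h1 : ∀ t, (Ici (p j).2).indicator (fun _ => (1 : ℝ)) t * deriv φ t =
        (Ici (p j).2).indicator (deriv φ) t := fun t => by
      by_cases h : t ∈ Ici (p j).2 <;> simp [h]
    simp_rw [h1]
    have hset : (Ioo 0 l ∩ Ici (p j).2 : Set ℝ) =ᵐ[volume] (Ioc (p j).2 l : Set ℝ) := by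
      have h2 : (Ioo 0 l ∩ Ici (p j).2 : Set ℝ) =ᵐ[volume] (Ioc 0 l ∩ Ioi (p j).2 : Set ℝ) :=
        ae_eq_set_inter Ioo_ae_eq_Ioc Ioi_ae_eq_Ici.symm
      rwa [Ioc_inter_Ioi, sup_eq_right.2 (hp' j).1] at h2
    rw [setIntegral_indicator measurableSet_Ici, setIntegral_congr_set hset,
      ← intervalIntegral.integral_of_le (hp' j).2,
      intervalIntegral.integral_deriv_eq_sub' φ rfl
        (fun x _ => (hφ.1.differentiable (by simp)).differentiableAt) hd.continuousOn,
      hφ.apply_right]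
    rw [← sub_mul]
    rcases le_total 0 (p j).1 with h | h
    · rw [ENNReal.toReal_ofReal h, ENNReal.ofReal_of_nonpos (by linarith)]; simp
    · rw [ENNReal.toReal_ofReal (show 0 ≤ -(p j).1 by linarith), ENNReal.ofReal_of_nonpos h]; simp
  · intro j _
    have h0 : IntegrableOn (deriv φ) (Ioo 0 l) :=
      hd.continuousOn.integrableOn_Icc.mono_set Ioo_subset_Icc_self
    refine h0.bdd_mul (c := |(p j).1|)
      ((measurable_const.indicator measurableSet_Ici).const_mul _).aestronglyMeasurable
      (ae_of_all _ fun t => ?_)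
    by_cases h : t ∈ Ici (p j).2 <;> simp [h]

theorem IsBVOn.congr_ae {a b : ℝ} {f g : ℝ → ℝ} (hf : IsBVOn a b f)
    (h : f =ᵐ[volume.restrict (Ioo a b)] g) : IsBVOn a b g := by
  obtain ⟨hi, p, n, hp, hn, hpn⟩ := hf
  refine ⟨hi.congr h, p, n, hp, hn, fun φ hφ => ?_⟩
  rw [← hpn φ hφ]
  exact integral_congr_ae (h.mono fun t ht => by simp only [ht])

/-- Away from the limit jump points, step functions converge together with their parameters. -/
theorem tendsto_jumpSum {p : ℕ → Fin K → ℝ × ℝ} {q : Fin K → ℝ × ℝ}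
    (hp : Tendsto p atTop (𝓝 q)) {s : ℝ} (hs : ∀ j, s ≠ (q j).2) :
    Tendsto (fun k => jumpSum (p k) s) atTop (𝓝 (jumpSum q s)) := by
  refine tendsto_finsetSum _ fun j _ => ?_
  have hj : Tendsto (fun k => p k j) atTop (𝓝 (q j)) := (tendsto_pi_nhds.1 hp) j
  refine Tendsto.mul ((continuous_fst.tendsto _).comp hj) ?_
  have h2 : Tendsto (fun k => (p k j).2) atTop (𝓝 (q j).2) := (continuous_snd.tendsto _).comp hj
  refine tendsto_const_nhds.congr' ?_
  rcases lt_or_gt_of_ne (hs j) with h | h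
  · filter_upwards [h2.eventually_const_lt h] with k hk
    simp [hk, h]
  · filter_upwards [h2.eventually_lt_const h] with k hk
    simp [hk.le, h.le]

theorem ae_forall_ne_jump (q : Fin K → ℝ × ℝ) (μ : Measure ℝ) [NullSingletonClass μ] :
    ∀ᵐ s ∂μ, ∀ j, s ≠ (q j).2 :=
  ae_all_iff.2 fun j => Measure.ae_ne μ (q j).2

theorem tendsto_integral_jumpSum_mul {p : ℕ → Fin K → ℝ × ℝ} {q : Fin K → ℝ × ℝ}
    (hp : Tendsto p atTop (𝓝 q)) (hp1 : ∀ k j, (p k j).1 ∈ Icc (-1 : ℝ) 1) {s : Set ℝ}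
    {g : ℝ → ℝ} (hg : IntegrableOn g s) :
    Tendsto (fun k => ∫ t in s, jumpSum (p k) t * g t) atTop
      (𝓝 (∫ t in s, jumpSum q t * g t)) := by
  refine tendsto_integral_of_dominated_convergence (fun t => K * ‖g t‖)
    (fun k => (measurable_jumpSum (p k)).aestronglyMeasurable.mul hg.aestronglyMeasurable)
    (hg.norm.const_mul _) (fun k => ae_of_all _ fun t => ?_) ?_
  · rw [norm_mul]
    gcongr
    exact abs_jumpSum_le (p k) (hp1 k) t
  · filter_upwards [ae_forall_ne_jump q _] with t ht
    exact (tendsto_jumpSum hp ht).mul_const _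

/-- Padding with the neutral parameter x₀ gives families of different sizes the same index type, so
that one parameter space serves a whole sequence. -/
theorem exists_fin_reindex {X : Type*} (J : Finset ℕ) (hJ : J.card ≤ K) (c : ℕ → X) (x₀ : X) :
    ∃ p : Fin K → X, (∀ j, p j = x₀ ∨ ∃ k ∈ J, p j = c k) ∧
      ∀ F : X → ℝ, F x₀ = 0 → ∑ j, F (p j) = ∑ k ∈ J, F (c k) := by
  classical
  have hcard : Fintype.card J ≤ Fintype.card (Fin K) := by simpa using hJ
  obtain ⟨f⟩ := Function.Embedding.nonempty_of_card_le hcard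
  refine ⟨Function.extend f (fun k => c k) fun _ => x₀, fun j => ?_, fun F hF => ?_⟩
  · by_cases h : ∃ k, f k = j
    · obtain ⟨k, rfl⟩ := h
      exact Or.inr ⟨k, k.2, f.injective.extend_apply _ _ _⟩
    · exact Or.inl (Function.extend_apply' _ _ _ h)
  · rw [← Finset.sum_coe_sort J fun k => F (c k)]
    refine (Finset.sum_of_injOn f f.injective.injOn (fun _ _ => Finset.mem_coe.2 (Finset.mem_univ _))
      (fun j _ hj => ?_) fun k _ => ?_).symm
    · rw [Function.extend_apply' _ _ _ fun ⟨k, hk⟩ => hj ⟨k, by simp, hk⟩, hF]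
    · rw [f.injective.extend_apply]

/-- A grid pattern with few jumps is given by few parameters. -/
theorem exists_jumpSum_eq_stepFun {l : ℝ} (hl : 0 < l) (n M : ℕ) (b : ℕ → ℝ)
    (hb : ∀ i, b i = 0 ∨ b i = 1) (hM : ∑ k ∈ Finset.range n, |b k - b (k + 1)| ≤ M) :
    ∃ p : Fin (M + 1) → ℝ × ℝ, (∀ j, p j ∈ Icc (-1 : ℝ) 1 ×ˢ Icc 0 l) ∧
      ∀ s ∈ Ioo 0 l, jumpSum p s = stepFun (l / (n + 1 : ℕ)) b s := by
  set δ := l / (n + 1 : ℕ) with hδ'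
  have hδ : 0 < δ := by positivity
  have hnδ : ((n + 1 : ℕ) : ℝ) * δ = l := by rw [hδ']; field_simp
  -- The initial value counts as a jump at 0, which accounts for the extra slot in `Fin (M + 1)`;
  -- all later heights are true differences.
  let c : ℕ → ℝ := fun k => if k = 0 then b 0 else b k - b (k - 1)
  have hc : ∀ k, c k = 0 ∨ |c k| = 1 := by
    intro k
    simp only [c]
    rcases hb 0 with h0 | h0 <;> rcases hb k with h1 | h1 <;> rcases hb (k - 1) with h2 | h2 <;>
      split_ifs <;> simp [h0, h1, h2]
  have hcabs : ∀ k, |c k| ≤ 1 := fun k => by rcases hc k with h | h <;> simp [h]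
  have hcsum : ∀ m, ∑ k ∈ Finset.range (m + 1), c k = b m := by
    intro m
    rw [Finset.sum_range_succ']
    simp only [c, Nat.add_eq_zero_iff, one_ne_zero, and_false, if_false, if_true,
      Nat.add_sub_cancel, Finset.sum_range_sub]
    ring
  let J := (Finset.range (n + 1)).filter fun k => c k ≠ 0
  have hJ : J.card ≤ M + 1 := by
    have h1 : (J.card : ℝ) = ∑ k ∈ J, |c k| := by
      rw [Finset.cast_card]
      exact Finset.sum_congr rfl fun k hk =>
        ((hc k).resolve_left (Finset.mem_filter.1 hk).2).symm
    have h2 : ∑ k ∈ J, |c k| ≤ ∑ k ∈ Finset.range (n + 1), |c k| :=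
      Finset.sum_le_sum_of_subset_of_nonneg (Finset.filter_subset _ _) fun _ _ _ => abs_nonneg _
    have h3 : ∑ k ∈ Finset.range (n + 1), |c k| ≤ M + 1 := by
      rw [Finset.sum_range_succ']
      refine add_le_add (le_of_eq_of_le (Finset.sum_congr rfl fun k _ => ?_) hM) (hcabs 0)
      simp [c, abs_sub_comm]
    exact_mod_cast h1.le.trans (h2.trans h3)
  obtain ⟨p, hp, hsum⟩ := exists_fin_reindex J hJ (fun k : ℕ => ((c k, (k : ℝ) * δ) : ℝ × ℝ)) (0, 0)
  refine ⟨p, fun j => ?_, fun s hs => ?_⟩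
  · rcases hp j with h | ⟨k, hk, h⟩
    · rw [h]; exact ⟨by simp, le_rfl, hl.le⟩
    · rw [h]
      refine ⟨abs_le.1 (hcabs k), by positivity, ?_⟩
      rw [← hnδ]
      have := (Finset.mem_range.1 (Finset.mem_filter.1 hk).1).le
      simp only
      gcongr
  · have hfl : ⌊s / δ⌋₊ < n + 1 := by
      rw [Nat.floor_lt (div_nonneg hs.1.le hδ.le), div_lt_iff₀ hδ, hnδ]
      exact hs.2
    rw [jumpSum, hsum (fun x => x.1 * (Ici x.2).indicator (fun _ => (1 : ℝ)) s) (by simp),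
      stepFun, ← hcsum, Finset.sum_filter]
    have hterm : ∀ k, (if c k ≠ 0 then
        c k * (Ici (k * δ)).indicator (fun _ => (1 : ℝ)) s else 0) =
        if k ∈ Finset.range (⌊s / δ⌋₊ + 1) then c k else 0 := by
      intro k
      have hiff : k ∈ Finset.range (⌊s / δ⌋₊ + 1) ↔ s ∈ Ici (k * δ) := by
        rw [Finset.mem_range, Nat.lt_succ_iff, Nat.le_floor_iff (div_nonneg hs.1.le hδ.le),
          le_div_iff₀ hδ, mem_Ici]
      by_cases h : s ∈ Ici (k * δ)
      · rw [if_pos (hiff.2 h), indicator_of_mem h, mul_one]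
        by_cases h0 : c k = 0 <;> simp [h0]
      · rw [if_neg (mt hiff.1 h), indicator_of_notMem h, mul_zero, ite_self]
    simp only [hterm]
    rw [← Finset.sum_filter]
    refine Finset.sum_congr ?_ fun _ _ => rfl
    ext k
    simp only [Finset.mem_filter, Finset.mem_range]
    omega

end JumpSum

/-! ### Medians of finite measures on the line. -/

section Median

open Filter Topology

/-- A finite measure on the line has a median. -/
theorem MeasureTheory.Measure.exists_median (ν : Measure ℝ) [IsFiniteMeasure ν] :
    ∃ m : ℝ, ν (Iio m) ≤ ν univ / 2 ∧ ν (Ioi m) ≤ ν univ / 2 := by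
  rcases eq_or_ne (ν univ) 0 with h0 | h0
  · refine ⟨0, ?_, ?_⟩ <;> exact (measure_mono (subset_univ _)).trans (by rw [h0]; simp)
  have hfin := measure_ne_top ν univ
  have hhalf : ν univ / 2 < ν univ := ENNReal.half_lt_self h0 hfin
  have hcompl : ∀ {s : Set ℝ}, MeasurableSet s → ν univ / 2 ≤ ν s → ν sᶜ ≤ ν univ / 2 := by
    intro s hs h
    rw [measure_compl hs (measure_ne_top ν s), tsub_le_iff_right]
    calc ν univ = ν univ / 2 + ν univ / 2 := (ENNReal.add_halves _).symm
      _ ≤ _ := by gcongr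
  -- The median is the infimum of the points where the distribution function has reached one half.
  -- Approaching it from either side by a sequence gives the two bounds.
  let T : Set ℝ := {t | ν univ / 2 ≤ ν (Iic t)}
  have hTne : T.Nonempty :=
    (((tendsto_measure_Iic_atTop ν).eventually_const_lt hhalf).exists).imp fun t ht => ht.le
  obtain ⟨x, hx⟩ := ((tendsto_measure_Ici_atBot ν).eventually_const_lt hhalf).exists
  have hTbdd : BddBelow T := by
    refine ⟨x, fun t ht => ?_⟩
    by_contra! hlt
    have h1 : ν (Ici x) ≤ ν (Iic t)ᶜ := measure_mono fun y hy => by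
      simpa using hlt.trans_le hy
    exact absurd (h1.trans (hcompl measurableSet_Iic ht)) (not_le.2 hx)
  have hseq : ∀ k : ℕ, (0 : ℝ) < 1 / (k + 1) := fun k => by positivity
  have hanti : ∀ {i j : ℕ}, i ≤ j → 1 / ((j : ℝ) + 1) ≤ 1 / (i + 1) := fun h => by
    gcongr
  refine ⟨sInf T, ?_, ?_⟩
  · have hU : Iio (sInf T) = ⋃ k : ℕ, Iic (sInf T - 1 / (k + 1)) := by
      ext y
      simp only [mem_Iio, mem_iUnion, mem_Iic]
      constructor
      · intro hy
        obtain ⟨k, hk⟩ := exists_nat_one_div_lt (sub_pos.2 hy)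
        exact ⟨k, by linarith⟩
      · rintro ⟨k, hk⟩
        linarith [hseq k]
    have hmono : Monotone fun k : ℕ => Iic (sInf T - 1 / ((k : ℝ) + 1)) := fun i j h =>
      Iic_subset_Iic.2 (by linarith [hanti h])
    rw [hU, hmono.measure_iUnion]
    refine iSup_le fun k => ?_
    by_contra! h
    linarith [csInf_le hTbdd (show sInf T - 1 / ((k : ℝ) + 1) ∈ T from h.le), hseq k]
  · have hU : Ioi (sInf T) = ⋃ k : ℕ, Ioi (sInf T + 1 / (k + 1)) := by
      ext y
      simp only [mem_Ioi, mem_iUnion]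
      constructor
      · intro hy
        obtain ⟨k, hk⟩ := exists_nat_one_div_lt (sub_pos.2 hy)
        exact ⟨k, by linarith⟩
      · rintro ⟨k, hk⟩
        linarith [hseq k]
    have hmono : Monotone fun k : ℕ => Ioi (sInf T + 1 / ((k : ℝ) + 1)) := fun i j h =>
      Ioi_subset_Ioi (by linarith [hanti h])
    rw [hU, hmono.measure_iUnion]
    refine iSup_le fun k => ?_
    obtain ⟨t, ht, hlt⟩ := exists_lt_of_csInf_lt hTne
      (show sInf T < sInf T + 1 / ((k : ℝ) + 1) by linarith [hseq k])
    rw [← compl_Iic]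
    exact hcompl measurableSet_Iic (le_trans ht (measure_mono (Iic_subset_Iic.2 hlt.le)))

/-- Off s, g exceeds f by at least k; on s it falls short by at most k. As s carries at most half of
the mass, the gain outweighs the loss. -/
theorem lintegral_le_of_half {α : Type*} [MeasurableSpace α] (ν : Measure α) [IsFiniteMeasure ν]
    {f g : α → ℝ≥0∞} (hf : Measurable f) (hg : Measurable g) {k : ℝ≥0∞} (hk : k ≠ ⊤) {s : Set α}
    (hs : MeasurableSet s) (hhalf : ν s ≤ ν univ / 2) (h1 : ∀ x ∉ s, f x + k ≤ g x)
    (h2 : ∀ x ∈ s, f x ≤ g x + k) : ∫⁻ x, f x ∂ν ≤ ∫⁻ x, g x ∂ν := by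
  have hle : ν s ≤ ν sᶜ := by
    rw [measure_compl hs (measure_ne_top ν s)]
    refine ENNReal.le_sub_of_add_le_left (measure_ne_top ν s) ?_
    calc ν s + ν s ≤ ν univ / 2 + ν univ / 2 := by gcongr
      _ = ν univ := ENNReal.add_halves _
  have hpt : ∫⁻ x, f x + sᶜ.indicator (fun _ => k) x ∂ν ≤
      ∫⁻ x, g x + s.indicator (fun _ => k) x ∂ν := by
    refine lintegral_mono fun x => ?_
    by_cases hx : x ∈ s
    · simp [hx, h2 x hx]
    · simp [hx, h1 x hx]
  rw [lintegral_add_left hf, lintegral_add_left hg, lintegral_indicator_const hs.compl,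
    lintegral_indicator_const hs] at hpt
  have hfin : k * ν s ≠ ⊤ := ENNReal.mul_ne_top hk (measure_ne_top ν s)
  refine (ENNReal.add_le_add_iff_right hfin).1 (le_trans ?_ hpt)
  gcongr

/-- Medians minimise the mean distance. -/
theorem lintegral_enorm_sub_median_le (ν : Measure ℝ) [IsFiniteMeasure ν] {m : ℝ}
    (h1 : ν (Iio m) ≤ ν univ / 2) (h2 : ν (Ioi m) ≤ ν univ / 2) (c : ℝ) :
    ∫⁻ x, ‖x - m‖ₑ ∂ν ≤ ∫⁻ x, ‖x - c‖ₑ ∂ν := by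
  have hmeas : ∀ c : ℝ, Measurable fun x : ℝ => ‖x - c‖ₑ := fun c =>
    (measurable_id.sub_const c).enorm
  have hadd : ∀ y, ENNReal.ofReal |y| + ENNReal.ofReal |m - c| = ENNReal.ofReal (|y| + |m - c|) :=
    fun y => (ENNReal.ofReal_add (abs_nonneg _) (abs_nonneg _)).symm
  have htri : ∀ x, ‖x - m‖ₑ ≤ ‖x - c‖ₑ + ENNReal.ofReal |m - c| := fun x => by
    rw [Real.enorm_eq_ofReal_abs, Real.enorm_eq_ofReal_abs, hadd]
    refine ENNReal.ofReal_le_ofReal ?_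
    rw [abs_sub_comm m c]
    exact abs_sub_le _ _ _
  rcases le_total c m with h | h
  · refine lintegral_le_of_half ν (hmeas m) (hmeas c) (ENNReal.ofReal_ne_top (r := |m - c|))
      measurableSet_Iio h1 (fun x hx => ?_) fun x _ => htri x
    have hx' : m ≤ x := not_lt.1 hx
    rw [Real.enorm_eq_ofReal_abs, Real.enorm_eq_ofReal_abs, hadd]
    refine ENNReal.ofReal_le_ofReal ?_
    rw [abs_of_nonneg (by linarith), abs_of_nonneg (by linarith), abs_of_nonneg (by linarith)]
    linarith
  · refine lintegral_le_of_half ν (hmeas m) (hmeas c) (ENNReal.ofReal_ne_top (r := |m - c|))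
      measurableSet_Ioi h2 (fun x hx => ?_) fun x _ => htri x
    have hx' : x ≤ m := not_lt.1 hx
    rw [Real.enorm_eq_ofReal_abs, Real.enorm_eq_ofReal_abs, hadd]
    refine ENNReal.ofReal_le_ofReal ?_
    rw [abs_of_nonpos (by linarith), abs_of_nonpos (by linarith), abs_of_nonpos (by linarith)]
    linarith

end Median

/-! ### Lengths, L¹ norms and medians on the graph, reduced to the distribution of values. -/

namespace CompactMetricGraph

variable {V E : Type*} [Fintype V] [Fintype E] (Γ : CompactMetricGraph V E)

theorem coords_ae_eq (A : Set Γ.Point) (e : E) :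
    Γ.coords A e =ᵐ[volume] (Ioo 0 (Γ.len e) ∩ Γ.pt e ⁻¹' A : Set ℝ) :=
  ae_eq_set_inter Ioo_ae_eq_Icc.symm (ae_eq_refl _)

theorem length_eq (A : Set Γ.Point) :
    Γ.length A = ∑ e, volume (Ioo 0 (Γ.len e) ∩ Γ.pt e ⁻¹' A : Set ℝ) :=
  Finset.sum_congr rfl fun e _ => measure_congr (Γ.coords_ae_eq A e)

theorem measSet_iff (A : Set Γ.Point) :
    Γ.MeasSet A ↔ ∀ e, NullMeasurableSet (Ioo 0 (Γ.len e) ∩ Γ.pt e ⁻¹' A : Set ℝ) volume :=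
  forall_congr' fun e => ⟨fun h => h.congr (Γ.coords_ae_eq A e),
    fun h => h.congr (Γ.coords_ae_eq A e).symm⟩

theorem length_univ : Γ.length univ = ENNReal.ofReal (∑ e, Γ.len e) := by
  rw [length_eq, ENNReal.ofReal_sum_of_nonneg fun e _ => (Γ.len_pos e).le]
  simp

theorem length_univ_ne_top : Γ.length univ ≠ ⊤ := by
  rw [length_univ]; exact ENNReal.ofReal_ne_top

theorem length_add_length_compl {A : Set Γ.Point} (hA : Γ.MeasSet A) :
    Γ.length A + Γ.length Aᶜ = Γ.length univ := by
  rw [length_eq, length_eq, length_eq, ← Finset.sum_add_distrib]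
  refine Finset.sum_congr rfl fun e _ => ?_
  rw [preimage_univ, inter_univ,
    ← measure_inter_add_sdiff₀ (Ioo 0 (Γ.len e)) ((Γ.measSet_iff A).1 hA e)]
  congr 2 <;> ext t <;> simp +contextual [and_assoc]

theorem MemL1.aemeasurable {u : Γ.Point → ℝ} (hu : Γ.MemL1 u) (e : E) :
    AEMeasurable (Γ.onEdge u e) (volume.restrict (Ioo 0 (Γ.len e))) :=
  (hu e).aestronglyMeasurable.aemeasurable

/-- The distribution of the values of a function on the graph. -/
noncomputable def valueDist (u : Γ.Point → ℝ) : Measure ℝ :=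
  ∑ e, (volume.restrict (Ioo 0 (Γ.len e))).map (Γ.onEdge u e)

instance (u : Γ.Point → ℝ) : IsFiniteMeasure (Γ.valueDist u) := by
  unfold valueDist
  infer_instance

theorem valueDist_apply {u : Γ.Point → ℝ} (hu : Γ.MemL1 u) {B : Set ℝ} (hB : MeasurableSet B) :
    Γ.valueDist u B = Γ.length (u ⁻¹' B) := by
  rw [valueDist, Measure.finsetSum_apply, length_eq]
  refine Finset.sum_congr rfl fun e _ => ?_
  rw [Measure.map_apply_of_aemeasurable (MemL1.aemeasurable Γ hu e) hB,
    Measure.restrict_apply' measurableSet_Ioo, inter_comm]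
  rfl

theorem l1norm_sub_eq {u : Γ.Point → ℝ} (hu : Γ.MemL1 u) (c : ℝ) :
    Γ.l1norm (fun x => u x - c) = ∫⁻ x, ‖x - c‖ₑ ∂Γ.valueDist u := by
  rw [valueDist, lintegral_finsetSum_measure, l1norm]
  refine Finset.sum_congr rfl fun e _ => ?_
  have hm : Measurable fun x : ℝ => ‖x - c‖ₑ := (measurable_id.sub_const c).enorm
  rw [lintegral_map' hm.aemeasurable (MemL1.aemeasurable Γ hu e), eLpNorm_one_eq_lintegral_enorm]
  rfl

theorem isMedian_iff {u : Γ.Point → ℝ} (hu : Γ.MemL1 u) (m : ℝ) :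
    Γ.IsMedian u m ↔ Γ.valueDist u (Iio m) ≤ Γ.valueDist u univ / 2 ∧
      Γ.valueDist u (Ioi m) ≤ Γ.valueDist u univ / 2 := by
  rw [Γ.valueDist_apply hu measurableSet_Iio, Γ.valueDist_apply hu measurableSet_Ioi,
    Γ.valueDist_apply hu MeasurableSet.univ]
  rfl

theorem exists_isMedian {u : Γ.Point → ℝ} (hu : Γ.MemL1 u) : ∃ m, Γ.IsMedian u m := by
  obtain ⟨m, hm⟩ := (Γ.valueDist u).exists_median
  exact ⟨m, (Γ.isMedian_iff hu m).2 hm⟩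

theorem IsMedian.l1norm_le {u : Γ.Point → ℝ} (hu : Γ.MemL1 u) {m : ℝ} (hm : Γ.IsMedian u m)
    (c : ℝ) : Γ.l1norm (fun x => u x - m) ≤ Γ.l1norm (fun x => u x - c) := by
  rw [Γ.l1norm_sub_eq hu, Γ.l1norm_sub_eq hu]
  obtain ⟨h1, h2⟩ := (Γ.isMedian_iff hu m).1 hm
  exact lintegral_enorm_sub_median_le _ h1 h2 c

theorem l1norm_sub_eq_ofReal {u : Γ.Point → ℝ} (hu : Γ.MemL1 u) (c : ℝ) :
    Γ.l1norm (fun x => u x - c) =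
      ENNReal.ofReal (∑ e, ∫ t in (0 : ℝ)..Γ.len e, |Γ.onEdge u e t - c|) := by
  rw [ENNReal.ofReal_sum_of_nonneg fun e _ =>
    intervalIntegral.integral_nonneg (Γ.len_pos e).le fun t _ => abs_nonneg _]
  refine Finset.sum_congr rfl fun e _ => ?_
  have hi : IntegrableOn (fun t => Γ.onEdge u e t - c) (Ioo 0 (Γ.len e)) :=
    (hu e).sub (integrableOn_const (by simp))
  rw [← setIntegral_Ioo_eq_intervalIntegral (Γ.len_pos e).le, eLpNorm_one_eq_lintegral_enorm]
  exact (ofReal_integral_norm_eq_lintegral_enorm hi).symm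

theorem l1norm_sub_ne_zero {u : Γ.Point → ℝ} (hu : Γ.MemL1 u) (hc : ¬ Γ.AEConst u) (c : ℝ) :
    Γ.l1norm (fun x => u x - c) ≠ 0 := by
  contrapose! hc
  refine ⟨c, fun e => ?_⟩
  have h0 := (Finset.sum_eq_zero_iff.1 hc) e (Finset.mem_univ e)
  have hm : AEStronglyMeasurable (fun t => Γ.onEdge u e t - c)
      (volume.restrict (Ioo 0 (Γ.len e))) := (hu e).aestronglyMeasurable.sub aestronglyMeasurable_const
  filter_upwards [(eLpNorm_eq_zero_iff hm one_ne_zero).1 h0] with t ht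
  exact sub_eq_zero.1 ht

/-- The Cheeger inequality in terms of medians. -/
theorem GridIsoperimetric.mul_l1norm_le_TV {κ : ℝ} (hκ : Γ.GridIsoperimetric κ) (hκ0 : 0 ≤ κ)
    {u : Γ.Point → ℝ} (hu : Γ.MemL1 u) {m : ℝ} (hm : Γ.IsMedian u m) :
    ENNReal.ofReal κ * Γ.l1norm (fun x => u x - m) ≤ Γ.TV u := by
  by_cases hBV : Γ.MemBV u
  · rw [Γ.l1norm_sub_eq_ofReal hu, ← ENNReal.ofReal_mul hκ0]
    refine GridIsoperimetric.ofReal_mul_le_TV Γ hκ hκ0 hu hBV fun c => ?_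
    have h := IsMedian.l1norm_le Γ hu hm c
    rw [Γ.l1norm_sub_eq_ofReal hu, Γ.l1norm_sub_eq_ofReal hu] at h
    exact (ENNReal.ofReal_le_ofReal_iff (Finset.sum_nonneg fun e _ =>
      intervalIntegral.integral_nonneg (Γ.len_pos e).le fun t _ => abs_nonneg _)).1 h
  · rw [TV, if_neg hBV]; exact le_top

theorem onEdge_indicator (D : Set Γ.Point) (e : E) :
    Γ.onEdge (D.indicator fun _ => 1) e = (Γ.pt e ⁻¹' D).indicator fun _ => 1 := rfl

theorem MeasSet.nullMeasurableSet_preimage {D : Set Γ.Point} (hD : Γ.MeasSet D) (e : E) :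
    NullMeasurableSet (Γ.pt e ⁻¹' D) (volume.restrict (Ioo 0 (Γ.len e))) := by
  rw [nullMeasurableSet_restrict measurableSet_Ioo.nullMeasurableSet, inter_comm]
  exact (Γ.measSet_iff D).1 hD e

theorem MeasSet.compl {D : Set Γ.Point} (hD : Γ.MeasSet D) : Γ.MeasSet Dᶜ := by
  refine (Γ.measSet_iff _).2 fun e => ?_
  have := (MeasSet.nullMeasurableSet_preimage Γ hD e).compl
  rwa [nullMeasurableSet_restrict measurableSet_Ioo.nullMeasurableSet, inter_comm] at this

theorem memL1_indicator {D : Set Γ.Point} (hD : Γ.MeasSet D) :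
    Γ.MemL1 (D.indicator fun _ => 1) := fun e =>
  (integrable_const (1 : ℝ)).indicator₀ (MeasSet.nullMeasurableSet_preimage Γ hD e)

theorem l1norm_eq_length {f : Γ.Point → ℝ} {A : Set Γ.Point} (hA : Γ.MeasSet A)
    (hf : ∀ x, |f x| = A.indicator (fun _ => 1) x) : Γ.l1norm f = Γ.length A := by
  rw [length_eq]
  refine Finset.sum_congr rfl fun e _ => ?_
  have h : ∀ t, ‖Γ.onEdge f e t‖ₑ = (Γ.pt e ⁻¹' A).indicator (fun _ => 1) t := fun t => by
    rw [Real.enorm_eq_ofReal_abs, onEdge, hf]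
    by_cases ht : Γ.pt e t ∈ A <;> simp [ht]
  rw [eLpNorm_one_eq_lintegral_enorm]
  simp_rw [h]
  rw [lintegral_indicator_const₀ (MeasSet.nullMeasurableSet_preimage Γ hA e), one_mul,
    Measure.restrict_apply' measurableSet_Ioo, inter_comm]

theorem AEConst.exists_l1norm_eq_zero {u : Γ.Point → ℝ} (hu : Γ.AEConst u) :
    ∃ c : ℝ, Γ.l1norm (fun x => u x - c) = 0 := by
  obtain ⟨c, hc⟩ := hu
  refine ⟨c, Finset.sum_eq_zero fun e _ => ?_⟩
  exact (eLpNorm_congr_ae (f := Γ.onEdge (fun x => u x - c) e) (g := fun _ => (0 : ℝ))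
    ((hc e).mono fun t ht => sub_eq_zero.2 ht)).trans (by simp)

/-- The median is 0 if D has at most half of the length, and 1 otherwise. This identifies Cheeger
quotients of sets with median quotients of indicators. -/
theorem exists_isMedian_indicator {D : Set Γ.Point} (hD : Γ.MeasSet D) :
    ∃ m : ℝ, Γ.IsMedian (D.indicator fun _ => 1) m ∧
      Γ.l1norm (fun x => D.indicator (fun _ => 1) x - m) = min (Γ.length D) (Γ.length Dᶜ) := by
  have hadd := Γ.length_add_length_compl hD
  have hhalf := ENNReal.add_halves (Γ.length univ)
  have hempty : Γ.length ∅ = 0 := by rw [length_eq]; simp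
  rcases le_or_gt (Γ.length D) (Γ.length univ / 2) with h | h
  · refine ⟨0, ⟨?_, ?_⟩, ?_⟩
    · have : {x | D.indicator (fun _ => (1 : ℝ)) x < 0} = ∅ := by
        ext x; by_cases hx : x ∈ D <;> simp [hx]
      rw [this, hempty]; exact zero_le
    · have : {x | 0 < D.indicator (fun _ => (1 : ℝ)) x} = D := by
        ext x; by_cases hx : x ∈ D <;> simp [hx]
      rwa [this]
    · rw [min_eq_left]
      · exact Γ.l1norm_eq_length hD fun x => by by_cases hx : x ∈ D <;> simp [hx]
      · by_contra! hlt
        have := ENNReal.add_lt_add_of_le_of_lt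
          (ne_top_of_le_ne_top Γ.length_univ_ne_top (h.trans ENNReal.half_le_self)) h
          (hlt.trans_le h)
        rw [hadd, hhalf] at this
        exact lt_irrefl _ this
  · have hc : Γ.length Dᶜ ≤ Γ.length univ / 2 := by
      by_contra! hlt
      have := ENNReal.add_lt_add h hlt
      rw [hadd, hhalf] at this
      exact lt_irrefl _ this
    refine ⟨1, ⟨?_, ?_⟩, ?_⟩
    · have : {x | D.indicator (fun _ => (1 : ℝ)) x < 1} = Dᶜ := by
        ext x; by_cases hx : x ∈ D <;> simp [hx]
      rwa [this]
    · have : {x | 1 < D.indicator (fun _ => (1 : ℝ)) x} = ∅ := by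
        ext x; by_cases hx : x ∈ D <;> simp [hx]
      rw [this, hempty]; exact zero_le
    · rw [min_eq_right (hc.trans h.le)]
      exact Γ.l1norm_eq_length (MeasSet.compl Γ hD) fun x => by
        by_cases hx : x ∈ D <;> simp [hx]

/-- An almost everywhere constant function has L¹ distance zero to some c, hence to its median,
which would make D or its complement null. -/
theorem not_aeConst_indicator {D : Set Γ.Point} (hD : Γ.MeasSet D) (h0 : 0 < Γ.length D)
    (h1 : Γ.length D < Γ.length univ) : ¬ Γ.AEConst (D.indicator fun _ => 1) := by
  intro h
  obtain ⟨c, hc⟩ := AEConst.exists_l1norm_eq_zero Γ h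
  obtain ⟨m, hm, hmin⟩ := Γ.exists_isMedian_indicator hD
  have hle := IsMedian.l1norm_le Γ (Γ.memL1_indicator hD) hm c
  rw [hc, hmin, min_le_iff, nonpos_iff_eq_zero, nonpos_iff_eq_zero] at hle
  rcases hle with h | h
  · exact h0.ne' h
  · have hadd := Γ.length_add_length_compl hD
    rw [h, add_zero] at hadd
    exact h1.ne hadd

end CompactMetricGraph

/-! ### Grid quotients, their infimum, and sets given by jump parameters. -/

namespace CompactMetricGraph

open Filter Topology

variable {V E : Type*} [Fintype V] [Fintype E] (Γ : CompactMetricGraph V E)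

theorem sum_integral_stepFun (n : ℕ) (b : E → ℕ → ℝ) :
    ∑ e, ∫ t in Ioo 0 (Γ.len e), stepFun (Γ.len e / (n + 1 : ℕ)) (b e) t * 1 =
      Γ.gridLength n b := by
  refine Finset.sum_congr rfl fun e _ => ?_
  have hδ : 0 < Γ.len e / (n + 1 : ℕ) := div_pos (Γ.len_pos e) (by positivity)
  have hl : ((n + 1 : ℕ) : ℝ) * (Γ.len e / (n + 1 : ℕ)) = Γ.len e := by field_simp
  have h := integral_stepFun_mul (u := fun _ => 1) (k := n + 1) hδ (b e) intervalIntegrable_const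
  rw [hl] at h
  rw [setIntegral_Ioo_eq_intervalIntegral (Γ.len_pos e).le, h]
  refine Finset.sum_congr rfl fun i _ => ?_
  rw [intervalIntegral.integral_const, cell_length, smul_eq_mul, mul_one]

/-- Sampling the field at the nodes gives a nodal Kirchhoff field with the same pairing, so weak
duality applies. -/
theorem abs_sum_integral_stepFun_le_cut {n : ℕ} {b : E → ℕ → ℝ}
    (hb : ∀ e i, b e i = 0 ∨ b e i = 1) {z dz : E → ℝ → ℝ} (hz : Γ.IsKirchhoffField z dz)
    (hz1 : Γ.SupNormLeOne z) :
    |∑ e, ∫ t in Ioo 0 (Γ.len e), stepFun (Γ.len e / (n + 1 : ℕ)) (b e) t * dz e t| ≤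
      Γ.cut n b := by
  have hδ : ∀ e, 0 < Γ.len e / (n + 1 : ℕ) := fun e => div_pos (Γ.len_pos e) (by positivity)
  have hl : ∀ e, ((n + 1 : ℕ) : ℝ) * (Γ.len e / (n + 1 : ℕ)) = Γ.len e := fun e => by field_simp
  -- The truncation at the end of the edge keeps the bound by one valid for all indices, including
  -- those beyond the last node.
  let η : E → ℕ → ℝ := fun e i => z e (min (i * (Γ.len e / (n + 1 : ℕ))) (Γ.len e))
  have hmem : ∀ e (i : ℕ), min (i * (Γ.len e / (n + 1 : ℕ))) (Γ.len e) ∈ Icc 0 (Γ.len e) :=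
    fun e i => ⟨le_min (mul_nonneg (Nat.cast_nonneg _) (hδ e).le) (Γ.len_pos e).le,
      min_le_right _ _⟩
  have hη : Γ.IsNodalField n η := by
    refine ⟨fun e i => abs_le_one_of_ae_of_continuousOn (Γ.len_pos e) (hz.1 e).1 (hz1 e) _
      (hmem e i), fun v => ?_⟩
    rw [← hz.2 v]
    refine Finset.sum_congr rfl fun e _ => ?_
    simp [nodeValue, vertexValue, η, hl, (Γ.len_pos e).le, -Nat.cast_add]
  refine le_of_eq_of_le (congrArg _ (Finset.sum_congr rfl fun e _ => ?_))
    (Γ.abs_sum_cells_le_cut hb hη)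
  have h := integral_stepFun_mul (u := dz e) (k := n + 1) (hδ e) (b e)
    (by rw [hl]; exact (hz.1 e).intervalIntegrable (Γ.len_pos e).le)
  rw [hl] at h
  rw [setIntegral_Ioo_eq_intervalIntegral (Γ.len_pos e).le, h]
  refine Finset.sum_congr rfl fun i hi => ?_
  have hle : ((i + 1 : ℕ) : ℝ) * (Γ.len e / (n + 1 : ℕ)) ≤ Γ.len e := by
    have h1 : ((i + 1 : ℕ) : ℝ) ≤ (n + 1 : ℕ) := by exact_mod_cast Finset.mem_range.1 hi
    calc _ ≤ ((n + 1 : ℕ) : ℝ) * (Γ.len e / (n + 1 : ℕ)) := by gcongr; exact (hδ e).le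
      _ = _ := hl e
  have h1 : η e (i + 1) = z e ((i + 1 : ℕ) * (Γ.len e / (n + 1 : ℕ))) := by
    simp only [η]; rw [min_eq_left hle]
  have h2 : η e i = z e (i * (Γ.len e / (n + 1 : ℕ))) := by
    simp only [η]; rw [min_eq_left ((cell_le (hδ e) i).trans hle)]
  have hm1 := hmem e (i + 1)
  have hm2 := hmem e i
  rw [min_eq_left hle] at hm1
  rw [min_eq_left ((cell_le (hδ e) i).trans hle)] at hm2
  rw [h1, h2, (hz.1 e).integral_eq_sub (Γ.len_pos e) hm2 hm1]

theorem gridLength_mem_Icc {n : ℕ} {b : E → ℕ → ℝ} (hb : ∀ e i, b e i = 0 ∨ b e i = 1) :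
    Γ.gridLength n b ∈ Icc 0 (∑ e, Γ.len e) := by
  have hq : ∀ e, 0 ≤ Γ.len e / (n + 1 : ℕ) := fun e =>
    div_nonneg (Γ.len_pos e).le (Nat.cast_nonneg _)
  constructor
  · refine Finset.sum_nonneg fun e _ => Finset.sum_nonneg fun i _ => mul_nonneg ?_ (hq e)
    rcases hb e i with h | h <;> simp [h]
  · rw [← Γ.sum_grid_lengths n]
    refine Finset.sum_le_sum fun e _ => Finset.sum_le_sum fun i _ => mul_le_of_le_one_left (hq e) ?_
    rcases hb e i with h | h <;> simp [h]

theorem one_le_cut {n : ℕ} {b : E → ℕ → ℝ} (hb : ∀ e i, b e i = 0 ∨ b e i = 1)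
    (h : 0 < min (Γ.gridLength n b) (∑ e, Γ.len e - Γ.gridLength n b)) : 1 ≤ Γ.cut n b := by
  by_contra! hlt
  obtain ⟨h1, h2⟩ := lt_min_iff.1 h
  rcases isEmpty_or_nonempty E with hE | ⟨⟨e₀⟩⟩
  · simp [gridLength] at h1
  have hconst : ∀ e, ∀ i ∈ Finset.range (n + 1), b e i = b e₀ 0 := fun e i hi =>
    Γ.eq_of_cut_lt_one hb hlt e e₀ (Nat.lt_succ_iff.1 (Finset.mem_range.1 hi)) (Nat.zero_le n)
  have hL : Γ.gridLength n b = b e₀ 0 * ∑ e, Γ.len e := by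
    rw [← Γ.sum_grid_lengths n, Finset.mul_sum]
    refine Finset.sum_congr rfl fun e _ => ?_
    rw [Finset.mul_sum]
    exact Finset.sum_congr rfl fun i hi => by rw [hconst e i hi]
  rcases hb e₀ 0 with h0 | h0 <;> rw [h0] at hL <;> linarith

/-- The isoperimetric quotients of the nontrivial grid patterns. -/
def gridQuotients : Set ℝ :=
  {r | ∃ (n : ℕ) (b : E → ℕ → ℝ), (∀ e i, b e i = 0 ∨ b e i = 1) ∧
    0 < min (Γ.gridLength n b) (∑ e, Γ.len e - Γ.gridLength n b) ∧
    Γ.cut n b = r * min (Γ.gridLength n b) (∑ e, Γ.len e - Γ.gridLength n b)}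

theorem gridQuotients_nonneg {r : ℝ} (hr : r ∈ Γ.gridQuotients) : 0 ≤ r := by
  obtain ⟨n, b, hb, h0, h⟩ := hr
  exact nonneg_of_mul_nonneg_left (h ▸ Γ.cut_nonneg hb) h0

theorem bddBelow_gridQuotients : BddBelow Γ.gridQuotients :=
  ⟨0, fun _ hr => Γ.gridQuotients_nonneg hr⟩

theorem gridQuotients_nonempty [Nonempty E] : Γ.gridQuotients.Nonempty := by
  have hlen : 0 < ∑ e, Γ.len e := Finset.sum_pos (fun e _ => Γ.len_pos e) Finset.univ_nonempty
  let b : E → ℕ → ℝ := fun _ i => if i = 0 then 1 else 0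
  have hb : ∀ e i, b e i = 0 ∨ b e i = 1 := fun e i => by
    simp only [b]; split_ifs <;> simp
  have hL : Γ.gridLength 1 b = (∑ e, Γ.len e) / 2 := by
    rw [gridLength, Finset.sum_div]
    refine Finset.sum_congr rfl fun e _ => ?_
    norm_num [Finset.sum_range_succ, b]
  have hpos : 0 < min (Γ.gridLength 1 b) (∑ e, Γ.len e - Γ.gridLength 1 b) := by
    rw [hL]; exact lt_min (by linarith) (by linarith)
  exact ⟨_, 1, b, hb, hpos, (div_mul_cancel₀ _ hpos.ne').symm⟩

theorem gridIsoperimetric_sInf [Nonempty E] : Γ.GridIsoperimetric (sInf Γ.gridQuotients) := by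
  intro n b hb
  rcases le_or_gt (min (Γ.gridLength n b) (∑ e, Γ.len e - Γ.gridLength n b)) 0 with h | h
  · exact (mul_nonpos_of_nonneg_of_nonpos
      (le_csInf Γ.gridQuotients_nonempty fun r hr => Γ.gridQuotients_nonneg hr) h).trans
      (Γ.cut_nonneg hb)
  · rw [← le_div_iff₀ h]
    exact csInf_le Γ.bddBelow_gridQuotients ⟨n, b, hb, h, (div_mul_cancel₀ _ h.ne').symm⟩

/-- The set on which the step functions with parameters `p` take the value one. -/
def jumpSet {K : ℕ} (p : E → Fin K → ℝ × ℝ) : Set Γ.Point :=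
  {x | ∃ (e : E) (t : ℝ) (ht : t ∈ Ioo 0 (Γ.len e)), x = .inner e t ht ∧ jumpSum (p e) t = 1}

theorem pt_mem_jumpSet {K : ℕ} (p : E → Fin K → ℝ × ℝ) {e : E} {t : ℝ}
    (ht : t ∈ Ioo 0 (Γ.len e)) : Γ.pt e t ∈ Γ.jumpSet p ↔ jumpSum (p e) t = 1 := by
  rw [pt, dif_pos ht]
  constructor
  · rintro ⟨e', t', ht', h, h1⟩
    injection h with h2 h3
    rw [h2, h3]; exact h1
  · exact fun h => ⟨e, t, ht, rfl, h⟩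

theorem measSet_jumpSet {K : ℕ} (p : E → Fin K → ℝ × ℝ) : Γ.MeasSet (Γ.jumpSet p) := by
  refine (Γ.measSet_iff _).2 fun e => ?_
  have : Ioo 0 (Γ.len e) ∩ Γ.pt e ⁻¹' Γ.jumpSet p = Ioo 0 (Γ.len e) ∩ jumpSum (p e) ⁻¹' {1} := by
    ext t
    exact and_congr_right fun ht => Γ.pt_mem_jumpSet p ht
  rw [this]
  exact (measurableSet_Ioo.inter
    (measurable_jumpSum _ (measurableSet_singleton 1))).nullMeasurableSet

theorem onEdge_jumpSet_ae_eq {K : ℕ} (p : E → Fin K → ℝ × ℝ) (e : E)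
    (h : ∀ᵐ t ∂volume.restrict (Ioo 0 (Γ.len e)), jumpSum (p e) t = 0 ∨ jumpSum (p e) t = 1) :
    jumpSum (p e) =ᵐ[volume.restrict (Ioo 0 (Γ.len e))]
      Γ.onEdge ((Γ.jumpSet p).indicator fun _ => 1) e := by
  filter_upwards [h, ae_restrict_mem measurableSet_Ioo] with t ht htm
  rw [onEdge_indicator]
  have hiff : t ∈ Γ.pt e ⁻¹' Γ.jumpSet p ↔ jumpSum (p e) t = 1 := Γ.pt_mem_jumpSet p htm
  rcases ht with ht | ht
  · rw [indicator_of_notMem (by rw [hiff, ht]; norm_num), ht]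
  · rw [indicator_of_mem (hiff.2 ht), ht]

theorem length_eq_ofReal_integral {D : Set Γ.Point} (hD : Γ.MeasSet D) :
    Γ.length D = ENNReal.ofReal
      (∑ e, ∫ t in Ioo 0 (Γ.len e), Γ.onEdge (D.indicator fun _ => 1) e t * 1) := by
  have h0 : ∀ e t, 0 ≤ Γ.onEdge (D.indicator fun _ => 1) e t := fun e t =>
    indicator_nonneg (fun _ _ => zero_le_one) _
  have h1 := Γ.l1norm_eq_length (f := fun x => D.indicator (fun _ => 1) x - 0) hD fun x => by
    by_cases hx : x ∈ D <;> simp [hx]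
  rw [← h1, Γ.l1norm_sub_eq_ofReal (Γ.memL1_indicator hD)]
  congr 1
  refine Finset.sum_congr rfl fun e _ => ?_
  rw [← setIntegral_Ioo_eq_intervalIntegral (Γ.len_pos e).le]
  simp only [sub_zero, mul_one, abs_of_nonneg (h0 e _)]

end CompactMetricGraph

/-! ### Compactness of minimising patterns and existence of an optimal set. -/

namespace CompactMetricGraph

open Filter Topology

variable {V E : Type*} [Fintype V] [Fintype E] (Γ : CompactMetricGraph V E)

/-- A minimising sequence of grid patterns has a subsequence whose step functions converge. -/
theorem exists_minimizing_parameters [Nonempty E] :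
    ∃ (M : ℕ) (n : ℕ → ℕ) (b : ℕ → E → ℕ → ℝ) (r : ℕ → ℝ) (p : ℕ → E → Fin (M + 1) → ℝ × ℝ)
      (q : E → Fin (M + 1) → ℝ × ℝ),
      (∀ k e i, b k e i = 0 ∨ b k e i = 1) ∧
      (∀ k, 0 < min (Γ.gridLength (n k) (b k)) (∑ e, Γ.len e - Γ.gridLength (n k) (b k))) ∧
      (∀ k, Γ.cut (n k) (b k) =
        r k * min (Γ.gridLength (n k) (b k)) (∑ e, Γ.len e - Γ.gridLength (n k) (b k))) ∧
      Tendsto r atTop (𝓝 (sInf Γ.gridQuotients)) ∧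
      (∀ k e, ∀ s ∈ Ioo 0 (Γ.len e),
        jumpSum (p k e) s = stepFun (Γ.len e / (n k + 1 : ℕ)) (b k e) s) ∧
      (∀ k e j, p k e j ∈ Icc (-1 : ℝ) 1 ×ˢ Icc 0 (Γ.len e)) ∧
      (∀ e j, q e j ∈ Icc (-1 : ℝ) 1 ×ˢ Icc 0 (Γ.len e)) ∧ Tendsto p atTop (𝓝 q) := by
  obtain ⟨r, -, hr, hrQ⟩ := exists_seq_tendsto_sInf Γ.gridQuotients_nonempty
    Γ.bddBelow_gridQuotients
  choose n b hb hpos hcut using hrQ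
  obtain ⟨R, hR⟩ := hr.bddAbove_range
  -- A convergent sequence of quotients is bounded and the lengths are at most the total length, so
  -- M bounds all cuts and thereby the number of jumps on each edge.
  obtain ⟨M, hM⟩ := exists_nat_ge (R * ∑ e, Γ.len e)
  have hcutM : ∀ k, Γ.cut (n k) (b k) ≤ M := by
    intro k
    refine le_trans ?_ hM
    rw [hcut k]
    have h1 : r k ≤ R := hR (mem_range_self k)
    have h2 : min (Γ.gridLength (n k) (b k)) (∑ e, Γ.len e - Γ.gridLength (n k) (b k)) ≤
        ∑ e, Γ.len e := (min_le_left _ _).trans (Γ.gridLength_mem_Icc (hb k)).2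
    have h3 : 0 ≤ R := (Γ.gridQuotients_nonneg ⟨n k, b k, hb k, hpos k, hcut k⟩).trans h1
    exact mul_le_mul h1 h2 (hpos k).le h3
  choose p hp hpeq using fun k e => exists_jumpSum_eq_stepFun (Γ.len_pos e) (n k) M (b k e)
    (hb k e) ((Γ.sum_jumps_le_cut (hb k) e).trans (hcutM k))
  have hcompact : IsCompact (Set.pi univ fun e : E => Set.pi univ fun _ : Fin (M + 1) =>
      Icc (-1 : ℝ) 1 ×ˢ Icc 0 (Γ.len e)) :=
    isCompact_univ_pi fun e => isCompact_univ_pi fun _ => isCompact_Icc.prod isCompact_Icc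
  obtain ⟨q, hq, φ, hφ, hlim⟩ := hcompact.tendsto_subseq (x := p)
    fun k e _ j _ => hp k e j
  exact ⟨M, n ∘ φ, b ∘ φ, r ∘ φ, p ∘ φ, q, fun k => hb (φ k), fun k => hpos (φ k),
    fun k => hcut (φ k), hr.comp hφ.tendsto_atTop, fun k => hpeq (φ k), fun k => hp (φ k),
    fun e j => hq e (mem_univ e) j (mem_univ j), hlim⟩

/-- The optimal isoperimetric quotient of grid patterns is attained by a measurable set. -/
theorem exists_optimal_set [Nonempty E] :
    ∃ D : Set Γ.Point, Γ.MeasSet D ∧ 0 < Γ.length D ∧ Γ.length D < Γ.length univ ∧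
      Γ.Per D ≤ ENNReal.ofReal (sInf Γ.gridQuotients) * min (Γ.length D) (Γ.length Dᶜ) := by
  obtain ⟨M, n, b, r, p, q, hb, hpos, hcut, hr, hpeq, hp, hq, hlim⟩ :=
    Γ.exists_minimizing_parameters
  set κ := sInf Γ.gridQuotients with hκ
  have hlime : ∀ e, Tendsto (fun k => p k e) atTop (𝓝 (q e)) := fun e =>
    (tendsto_pi_nhds.1 hlim) e
  have h01 : ∀ e, ∀ᵐ t ∂volume.restrict (Ioo 0 (Γ.len e)),
      jumpSum (q e) t = 0 ∨ jumpSum (q e) t = 1 := by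
    intro e
    filter_upwards [ae_forall_ne_jump (q e) _, ae_restrict_mem measurableSet_Ioo] with t ht htm
    have hcl : IsClosed ({0, 1} : Set ℝ) := (Set.toFinite _).isClosed
    refine hcl.mem_of_tendsto (tendsto_jumpSum (hlime e) ht) (Eventually.of_forall fun k => ?_)
    rw [hpeq k e t htm]
    exact hb k e _
  have hae := fun e => Γ.onEdge_jumpSet_ae_eq q e (h01 e)
  set D := Γ.jumpSet q with hD
  have hDm : Γ.MeasSet D := Γ.measSet_jumpSet q
  have hint : ∀ g : E → ℝ → ℝ, (∀ e, IntegrableOn (g e) (Ioo 0 (Γ.len e))) →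
      Tendsto (fun k => ∑ e, ∫ t in Ioo 0 (Γ.len e),
        stepFun (Γ.len e / (n k + 1 : ℕ)) (b k e) t * g e t) atTop
        (𝓝 (∑ e, ∫ t in Ioo 0 (Γ.len e), Γ.onEdge (D.indicator fun _ => 1) e t * g e t)) := by
    intro g hg
    refine tendsto_finsetSum _ fun e _ => ?_
    have h1 := tendsto_integral_jumpSum_mul (hlime e) (fun k j => (hp k e j).1) (hg e)
    have h2 : ∫ t in Ioo 0 (Γ.len e), jumpSum (q e) t * g e t =
        ∫ t in Ioo 0 (Γ.len e), Γ.onEdge (D.indicator fun _ => 1) e t * g e t :=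
      integral_congr_ae ((hae e).mono fun t ht => by simp only [ht])
    rw [← h2]
    refine h1.congr fun k => setIntegral_congr_fun measurableSet_Ioo fun t ht => ?_
    simp only [hpeq k e t ht]
  set L := ∑ e, ∫ t in Ioo 0 (Γ.len e), Γ.onEdge (D.indicator fun _ => 1) e t * 1 with hL
  have hlenD : Γ.length D = ENNReal.ofReal L := Γ.length_eq_ofReal_integral hDm
  have hLlim : Tendsto (fun k => Γ.gridLength (n k) (b k)) atTop (𝓝 L) := by
    have h := hint (fun _ _ => 1) fun e => by simp
    simpa only [Γ.sum_integral_stepFun] using h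
  have hminlim : Tendsto
      (fun k => min (Γ.gridLength (n k) (b k)) (∑ e, Γ.len e - Γ.gridLength (n k) (b k))) atTop
      (𝓝 (min L (∑ e, Γ.len e - L))) := hLlim.min (tendsto_const_nhds.sub hLlim)
  have hcutlim : Tendsto (fun k => Γ.cut (n k) (b k)) atTop
      (𝓝 (κ * min L (∑ e, Γ.len e - L))) := (hr.mul hminlim).congr fun k => (hcut k).symm
  have hκ0 : 0 ≤ κ := le_csInf Γ.gridQuotients_nonempty fun r hr => Γ.gridQuotients_nonneg hr
  have hmin0 : 0 ≤ min L (∑ e, Γ.len e - L) :=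
    ge_of_tendsto' hminlim fun k => (hpos k).le
  -- No collapse: all cuts are at least one, so the limit of the cuts is too, and the limiting
  -- smaller length cannot vanish.
  have hone : 1 ≤ κ * min L (∑ e, Γ.len e - L) :=
    ge_of_tendsto' hcutlim fun k => Γ.one_le_cut (hb k) (hpos k)
  have hminpos : 0 < min L (∑ e, Γ.len e - L) :=
    lt_of_le_of_ne hmin0 fun h => by rw [← h, mul_zero] at hone; linarith
  obtain ⟨hLpos, hLlt⟩ := lt_min_iff.1 hminpos
  have hlenDc : Γ.length Dᶜ = ENNReal.ofReal (∑ e, Γ.len e - L) := by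
    have h := Γ.length_add_length_compl hDm
    rw [hlenD, Γ.length_univ] at h
    rw [ENNReal.ofReal_sub _ hLpos.le, ← h, ENNReal.add_sub_cancel_left ENNReal.ofReal_ne_top]
  refine ⟨D, hDm, ?_, ?_, ?_⟩
  · rw [hlenD]; exact ENNReal.ofReal_pos.2 hLpos
  · rw [hlenD, Γ.length_univ]
    exact (ENNReal.ofReal_lt_ofReal_iff (by linarith)).2 (by linarith)
  have hBV : Γ.MemBV (D.indicator fun _ => 1) := fun e =>
    (isBVOn_jumpSum (q e) (fun j => (hq e j).1) fun j => (hq e j).2).congr_ae (hae e)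
  rw [Per, TV, if_pos hBV, hlenD, hlenDc, ← ENNReal.ofReal_min, ← ENNReal.ofReal_mul hκ0]
  -- Lower semicontinuity: for each fixed test field the pairings converge and are bounded by the
  -- cuts, whose limit is κ times the smaller length.
  refine iSup_le fun z => iSup_le fun dz => iSup_le fun hz => iSup_le fun hz1 =>
    ENNReal.ofReal_le_ofReal ?_
  have hdz : ∀ e, IntegrableOn (dz e) (Ioo 0 (Γ.len e)) := fun e =>
    (intervalIntegrable_iff_integrableOn_Ioo_of_le (Γ.len_pos e).le).1
      ((hz.1 e).intervalIntegrable (Γ.len_pos e).le)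
  exact le_of_tendsto_of_tendsto' (hint dz hdz).abs hcutlim fun k =>
    Γ.abs_sum_integral_stepFun_le_cut (hb k) hz hz1

theorem GridIsoperimetric.le_TV_div {κ : ℝ} (hκ : Γ.GridIsoperimetric κ) (hκ0 : 0 ≤ κ)
    {u : Γ.Point → ℝ} (hu : Γ.MemL1 u) (hc : ¬ Γ.AEConst u) {m : ℝ} (hm : Γ.IsMedian u m) :
    ENNReal.ofReal κ ≤ Γ.TV u / Γ.l1norm (fun x => u x - m) := by
  rw [ENNReal.le_div_iff_mul_le (Or.inl (Γ.l1norm_sub_ne_zero hu hc m)) (Or.inl (by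
    rw [Γ.l1norm_sub_eq_ofReal hu]; exact ENNReal.ofReal_ne_top))]
  exact GridIsoperimetric.mul_l1norm_le_TV Γ hκ hκ0 hu hm

end CompactMetricGraph

/-! ### The Cheeger constant as a minimum over medians and as an inf-sup. -/

theorem mainTheorem8 {V E : Type*} [Fintype V] [Fintype E] [Nonempty E]
    (Γ : CompactMetricGraph V E) :
    IsLeast {r : ℝ≥0∞ | ∃ (u : Γ.Point → ℝ) (μ : ℝ),
        Γ.MemL1 u ∧ ¬ Γ.AEConst u ∧ Γ.IsMedian u μ ∧
          r = Γ.TV u / Γ.l1norm (fun x => u x - μ)} Γ.cheeger ∧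
    Γ.cheeger = ⨅ (u : Γ.Point → ℝ) (_ : Γ.MemL1 u) (_ : ¬ Γ.AEConst u),
        ⨆ c : ℝ, Γ.TV u / Γ.l1norm (fun x => u x - c) := by
  set κ := sInf Γ.gridQuotients
  have hκ : Γ.GridIsoperimetric κ := Γ.gridIsoperimetric_sInf
  have hκ0 : 0 ≤ κ := le_csInf Γ.gridQuotients_nonempty fun r hr => Γ.gridQuotients_nonneg hr
  have hle : ∀ {u : Γ.Point → ℝ} (_ : Γ.MemL1 u) (_ : ¬ Γ.AEConst u) {m : ℝ}
      (_ : Γ.IsMedian u m), ENNReal.ofReal κ ≤ Γ.TV u / Γ.l1norm (fun x => u x - m) :=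
    fun hu hc _ hm => CompactMetricGraph.GridIsoperimetric.le_TV_div Γ hκ hκ0 hu hc hm
  obtain ⟨D, hD, hD0, hD1, hPer⟩ := Γ.exists_optimal_set
  have hquot : Γ.Per D / min (Γ.length D) (Γ.length Dᶜ) ≤ ENNReal.ofReal κ :=
    ENNReal.div_le_of_le_mul hPer
  have hcheeger : Γ.cheeger = ENNReal.ofReal κ := by
    refine le_antisymm (iInf_le_of_le D (iInf_le_of_le hD (iInf_le_of_le hD0
      (iInf_le_of_le hD1 hquot)))) ?_
    refine le_iInf fun A => le_iInf fun hA => le_iInf fun hA0 => le_iInf fun hA1 => ?_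
    obtain ⟨m, hm, hmin⟩ := Γ.exists_isMedian_indicator hA
    rw [← hmin]
    exact hle (Γ.memL1_indicator hA) (Γ.not_aeConst_indicator hA hA0 hA1) hm
  have hDL := Γ.memL1_indicator hD
  have hDc := Γ.not_aeConst_indicator hD hD0 hD1
  obtain ⟨m, hm, hmin⟩ := Γ.exists_isMedian_indicator hD
  have hTV : Γ.TV (D.indicator fun _ => 1) /
      Γ.l1norm (fun x => D.indicator (fun _ => 1) x - m) ≤ ENNReal.ofReal κ := by
    rw [hmin]; exact hquot
  rw [hcheeger]
  refine ⟨⟨⟨_, m, hDL, hDc, hm, le_antisymm (hle hDL hDc hm) hTV⟩, ?_⟩, le_antisymm ?_ ?_⟩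
  · rintro _ ⟨u, μ, hu, hc, hμ, rfl⟩
    exact hle hu hc hμ
  · refine le_iInf fun u => le_iInf fun hu => le_iInf fun hc => ?_
    obtain ⟨μ, hμ⟩ := Γ.exists_isMedian hu
    exact le_iSup_of_le μ (hle hu hc hμ)
  -- The indicator of D is the competitor: its median minimises the denominator, so no c gives a
  -- larger quotient.
  · refine iInf_le_of_le _ (iInf_le_of_le hDL (iInf_le_of_le hDc (iSup_le fun c => ?_)))
    exact (ENNReal.div_le_div_left
      (CompactMetricGraph.IsMedian.l1norm_le Γ hDL hm c) _).trans hTV
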